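/- **Setting.** Let $F,K\in\mathbb N$, $0<\epsilon<1$, $0<\epsilon'\le U$, and $$\mathcal C=\Big\{W\in\mathbb R_+^{F\times K}: \|W_{i:}\|_1\ge\epsilon,\ \|W_{:j}\|_\infty\le 1\ \ \forall i,j\Big\},\qquad \mathcal H=\{h\in\mathbb R^K:\epsilon'\le h_j\le U\ \ \forall j\}.$$ *Divergences.* Let $\mathcal D$ be the set of the following functions $d(x\Vert y)$ of $x,y\in\mathbb R_{++}^F$: the $\ell_1$ distance $\|x-y\|_1$; the $\ell_2$ distance $\|x-y\|$; the Huber loss $\sum_i h_a(x_i-y_i)$, $a>0$, with $h_a(u)=u^2/2$ for $|u|\le a$ and $h_a(u)=a(|u|-a/2)$ otherwise; the $\alpha$-divergence $\frac1{\alpha(\alpha-1)}\sum_i\big(y_i[(x_i/y_i)^\alpha-1]-\alpha(x_i-y_i)\big)$, $\alpha\ne0,1$ (for $\alpha=\frac12$ the Hellinger distance $2\sum_i(\sqrt{x_i}-\sqrt{y_i})^2$); the Kullback–Leibler divergence $\sum_i (x_i\log(x_i/y_i)-x_i+y_i)$; the Mahalanobis distance $(x-y)^TA(x-y)/2$ with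 $A$ symmetric positive definite; the $\beta$-divergence $\frac1{\beta(\beta-1)}\sum_i\big(x_i^\beta-y_i^\beta-\beta y_i^{\beta-1}(x_i-y_i)\big)$, $\beta\ne0,1$ (for $\beta=2$ the squared $\ell_2$ distance $\|x-y\|_2^2/2$); the Itakura–Saito divergence $\sum_i(\log(y_i/x_i)+x_i/y_i-1)$. Let $\mathcal D_1$ be the set of $d\in\mathcal D$ such that for every $x\in\mathbb R_{++}^F$ and every compact $\mathcal Y\subseteq\mathbb R_{++}^F$, $d(x\Vert\cdot)$ is differentiable at the points of $\mathcal Y$ with Lipschitz gradient on $\mathcal Y$, and $\mathcal D_2$ the set of $d\in\mathcal D$ such that $d(x\Vert\cdot)$ is convex on $\mathbb R_{++}^F$ for every $x\in\mathbb R_{++}^F$. *Losses.* Let $d\in\mathcal D_2$ and $\lambda\ge0$; the unregularized problem is $\lambda=0$, and a Tikhonov regularizer $\lambda>0$ is allowed if $d\in\mathcal D_1\cap\mathcal D_2$. For a Borel probability measure $\mathbb P$ on $\mathbb R^F$ put $$g(v,W,h)=d(v\Vert Wh)+\tfrac\lambda2\|h\|_2^2,\qquad \ell(v,W)=\min_{h\in\mathcal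 H}g(v,W,h),\qquad f(W)=\mathbb E_{v\sim\mathbb P}[\ell(v,W)].$$ *Critical points.* $x^*\in S$ is a critical point of $\min_{x\in S}\phi(x)$, $S$ convex, if for every $x\in S$ the directional derivative $\phi'(x^*;x-x^*)=\lim_{\delta\downarrow0}(\phi(x^*+\delta(x-x^*))-\phi(x^*))/\delta$ exists and is $\ge0$. *Algorithm.* Let $\eta_t\ge0$ with $\sum_t\eta_t=\infty$ and $\sum_t\eta_t^2<\infty$. Start from $W_0\in\mathcal C$. For $t=1,2,\dots$: draw $v_t\sim\mathbb P$ independently of the past; let $h_t$ be a critical point of $\min_{h\in\mathcal H}g(v_t,W_{t-1},h)$; set $W_t=\Pi_{\mathcal C}(W_{t-1}-\eta_tG_t)$, where $\Pi_{\mathcal C}$ is the Euclidean (Frobenius) projection onto $\mathcal C$ and $G_t$ is any element of the Fréchet subdifferential of $W\mapsto d(v_t\Vert Wh_t)$ at $W_{t-1}$. Here $W_0$, $h_t$ and $G_t$ may be random; $h_t$ and $G_t$ may depend on everything up to and including iteration $t$, but $W_0$ and all $v_s,h_s,G_s$, $s<t$, belong to the past of which $v_t$ is independent. **Theorem.** Assume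 that the support $\mathcal V$ of $\mathbb P$ is a compact subset of $\mathbb R_{++}^F$, and that there is $m>0$ such that $h\mapsto g(v,W,h)$ is $m$-strongly convex on $\mathcal H$ for all $(v,W)\in\mathcal V\times\mathcal C$. Then the minimum defining $\ell(v,W)$ is attained for all $(v,W)\in\mathcal V\times\mathcal C$; for every $W\in\mathcal C$, $\ell(\cdot,W)$ is $\mathbb P$-integrable and $f'(W;W'-W)$ exists for every $W'\in\mathcal C$; and almost surely $W_t$ converges, as $t\to\infty$, to the set $\mathcal S$ of critical points of $\min_{W\in\mathcal C}f(W)$, i.e. $\inf_{W\in\mathcal S}\|W_t-W\|\to0$ (in particular $\mathcal S\neq\emptyset$). -/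

import Mathlib

open MeasureTheory ProbabilityTheory Filter Topology

noncomputable section

namespace OnlineNMF

/-- Column vectors with the Euclidean norm. -/
abbrev Vec (n : ℕ) := EuclideanSpace ℝ (Fin n)

/-- `F × K` matrices with the Frobenius norm and inner product. -/
abbrev Mat (F K : ℕ) := EuclideanSpace ℝ (Fin F × Fin K)

/-- The matrix-vector product `W h`. -/
def mulVec {F K : ℕ} (W : Mat F K) (h : Vec K) : Vec F :=
  WithLp.toLp 2 fun i => ∑ j, W (i, j) * h j

/-- The open positive orthant. -/
def posOrthant (n : ℕ) : Set (Vec n) := {x | ∀ i, 0 < x i}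

/-! ### Divergences -/

/-- A divergence `d(x‖y)`; only its values for `x, y` in the positive orthant matter. -/
abbrev Divergence (n : ℕ) := Vec n → Vec n → ℝ

def l1Distance (n : ℕ) : Divergence n := fun x y => ∑ i, |x i - y i|

def l2Distance (n : ℕ) : Divergence n := fun x y => ‖x - y‖

def huber (a u : ℝ) : ℝ := if |u| ≤ a then u ^ 2 / 2 else a * (|u| - a / 2)

def huberLoss (n : ℕ) (a : ℝ) : Divergence n := fun x y => ∑ i, huber a (x i - y i)

def alphaDivergence (n : ℕ) (a : ℝ) : Divergence n := fun x y =>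
  1 / (a * (a - 1)) * ∑ i, (y i * ((x i / y i) ^ a - 1) - a * (x i - y i))

def klDivergence (n : ℕ) : Divergence n := fun x y =>
  ∑ i, (x i * Real.log (x i / y i) - x i + y i)

def mahalanobis (n : ℕ) (A : Matrix (Fin n) (Fin n) ℝ) : Divergence n := fun x y =>
  (∑ i, ∑ j, (x i - y i) * A i j * (x j - y j)) / 2

def betaDivergence (n : ℕ) (b : ℝ) : Divergence n := fun x y =>
  1 / (b * (b - 1)) *
    ∑ i, (x i ^ b - y i ^ b - b * y i ^ (b - 1) * (x i - y i))

def isDivergence (n : ℕ) : Divergence n := fun x y =>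
  ∑ i, (Real.log (y i / x i) + x i / y i - 1)

/-- The listed divergences. On the positive orthant the Hellinger distance
`2 ∑ (√xᵢ - √yᵢ)²` is the case `alpha (1/2)`, and the squared `ℓ₂` distance `‖x - y‖² / 2`
is the case `beta 2` (and `mahalanobis 1`). -/
inductive IsListed (n : ℕ) : Divergence n → Prop
  | l1 : IsListed n (l1Distance n)
  | l2 : IsListed n (l2Distance n)
  | huber (a : ℝ) (ha : 0 < a) : IsListed n (huberLoss n a)
  | alpha (a : ℝ) (h0 : a ≠ 0) (h1 : a ≠ 1) : IsListed n (alphaDivergence n a)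
  | kl : IsListed n (klDivergence n)
  | mahalanobis (A : Matrix (Fin n) (Fin n) ℝ) (hA : A.PosDef) : IsListed n (mahalanobis n A)
  | beta (b : ℝ) (h0 : b ≠ 0) (h1 : b ≠ 1) : IsListed n (betaDivergence n b)
  | itakuraSaito : IsListed n (isDivergence n)

/-- The class `𝒟`: functions that agree with a listed divergence on the common domain
`ℝ₊₊ⁿ × ℝ₊₊ⁿ`. -/
def classD (n : ℕ) : Set (Divergence n) :=
  {d | ∃ d₀, IsListed n d₀ ∧ ∀ x ∈ posOrthant n, ∀ y ∈ posOrthant n, d x y = d₀ x y}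

/-- The class `𝒟₁`: on every compact subset of the positive orthant, `d(x‖·)` is differentiable
with Lipschitz gradient. -/
def classD1 (n : ℕ) : Set (Divergence n) :=
  {d | d ∈ classD n ∧ ∀ x ∈ posOrthant n, ∀ Y ⊆ posOrthant n, IsCompact Y →
    (∀ y ∈ Y, DifferentiableAt ℝ (d x) y) ∧ ∃ L, LipschitzOnWith L (gradient (d x)) Y}

/-- The class `𝒟₂`: `d(x‖·)` is convex on the positive orthant. -/
def classD2 (n : ℕ) : Set (Divergence n) :=
  {d | d ∈ classD n ∧ ∀ x ∈ posOrthant n, ConvexOn ℝ (posOrthant n) (d x)}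

/-! ### Subgradients, directional derivatives, critical points, projections -/

section General

variable {E : Type*} [NormedAddCommGroup E] [InnerProductSpace ℝ E]

/-- The Fréchet subdifferential: all `g` with
`liminf_{y → x} (f y - f x - ⟨g, y - x⟩) / ‖y - x‖ ≥ 0`. -/
def frechetSubdifferential (f : E → ℝ) (x : E) : Set E :=
  {g | ∀ c > 0, ∀ᶠ y in 𝓝 x, -c * ‖y - x‖ ≤ f y - f x - inner ℝ g (y - x)}

/-- `D` is the one-sided directional derivative `f'(x; u)`. -/
def HasDirDeriv (f : E → ℝ) (x u : E) (D : ℝ) : Prop :=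
  Tendsto (fun δ : ℝ => (f (x + δ • u) - f x) / δ) (𝓝[>] 0) (𝓝 D)

/-- Critical points of `min_{x ∈ S} f x`: `f'(x; y - x)` exists and is `≥ 0` for all `y ∈ S`. -/
def criticalPoints (f : E → ℝ) (S : Set E) : Set E :=
  {x | x ∈ S ∧ ∀ y ∈ S, ∃ D, HasDirDeriv f x (y - x) D ∧ 0 ≤ D}

/-- `p` is the Euclidean projection of `x` onto `S`. -/
def IsProjection (S : Set E) (x p : E) : Prop :=
  p ∈ S ∧ ∀ y ∈ S, ‖x - p‖ ≤ ‖x - y‖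

end General

/-! ### The stochastic program -/

/-- The dictionaries: entrywise nonnegative, rows of `ℓ₁` norm at least `ε`, columns of `ℓ∞` norm
at most `1`. -/
def dictSet (F K : ℕ) (ε : ℝ) : Set (Mat F K) :=
  {W | (∀ i j, 0 ≤ W (i, j)) ∧ (∀ i, ε ≤ ∑ j, |W (i, j)|) ∧ ∀ j i, |W (i, j)| ≤ 1}

/-- The coefficient vectors: all entries in `[ε', U]`. -/
def coefSet (K : ℕ) (ε' U : ℝ) : Set (Vec K) := {h | ∀ i, ε' ≤ h i ∧ h i ≤ U}

/-- The per-sample objective `d(v‖Wh) + (lam / 2) ‖h‖²`; `lam = 0` means no regularizer. -/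
def sampleObj {F K : ℕ} (d : Divergence F) (lam : ℝ) (v : Vec F) (W : Mat F K) (h : Vec K) : ℝ :=
  d v (mulVec W h) + lam / 2 * ‖h‖ ^ 2

/-- The loss `ℓ(v, W)`: the minimum of the per-sample objective over `h ∈ H`. -/
def sampleLoss {F K : ℕ} (d : Divergence F) (lam : ℝ) (H : Set (Vec K)) (v : Vec F)
    (W : Mat F K) : ℝ :=
  sInf (sampleObj d lam v W '' H)

/-- The expected loss `f(W) = 𝔼_{v ∼ P} ℓ(v, W)`. -/
def expLoss {F K : ℕ} (d : Divergence F) (lam : ℝ) (H : Set (Vec K)) (P : Measure (Vec F))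
    (W : Mat F K) : ℝ :=
  ∫ v, sampleLoss d lam H v W ∂P

/-- A run of online NMF by projected stochastic subgradient descent. The iteration that takes
`W t` to `W (t + 1)` uses the sample `v t`, the coefficients `h t`, the subgradient `G t` and the
step size `η t`; `ℱ t` is the information available before that iteration. Any critical `h t` and
any Fréchet subgradient `G t` may be chosen, possibly at random. -/
structure IsOnlineNMF {F K : ℕ} {Ω : Type*} [mΩ : MeasurableSpace Ω] (μ : Measure Ω)
    (ℱ : Filtration ℕ mΩ) (P : Measure (Vec F)) (d : Divergence F) (lam : ℝ)
    (C : Set (Mat F K)) (H : Set (Vec K)) (η : ℕ → ℝ)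
    (v : ℕ → Ω → Vec F) (h : ℕ → Ω → Vec K) (G W : ℕ → Ω → Mat F K) : Prop where
  measurable_v : ∀ t, Measurable[ℱ (t + 1)] (v t)
  measurable_h : ∀ t, Measurable[ℱ (t + 1)] (h t)
  measurable_G : ∀ t, Measurable[ℱ (t + 1)] (G t)
  measurable_W : ∀ t, Measurable[ℱ t] (W t)
  /-- every sample has distribution `P` and is drawn independently of the past -/
  law_v : ∀ t, μ.map (v t) = P
  indep_v : ∀ t, Indep (MeasurableSpace.comap (v t) inferInstance) (ℱ t) μ
  init : ∀ᵐ ω ∂μ, W 0 ω ∈ C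
  coef : ∀ t, ∀ᵐ ω ∂μ, h t ω ∈ criticalPoints (sampleObj d lam (v t ω) (W t ω)) H
  subgrad : ∀ t, ∀ᵐ ω ∂μ,
    G t ω ∈ frechetSubdifferential (fun W' => d (v t ω) (mulVec W' (h t ω))) (W t ω)
  update : ∀ t, ∀ᵐ ω ∂μ, IsProjection C (W t ω - η t • G t ω) (W (t + 1) ω)

end OnlineNMF

end

namespace OnlineNMF

/-! ### A deterministic lemma on slowly varying sequences -/

/-! The expected loss is not convex, but it is convex up to a quadratic, and the algorithm is a
projected stochastic subgradient method for it; the Moreau envelope is a Lyapunov function.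

Weak convexity. Let `h` and `k` minimize the sample objective at `W` and at `Z`. Passing from `(W,
h)` to `(Z, k)` through `(W, k)`, strong convexity yields a gain `m / 2 * ‖k - h‖ ^ 2` and convexity
of the divergence yields a linear term with the gradient at `W k`. Replacing that gradient by the
one at `W h` costs a multiple of `‖k - h‖ * ‖Z - W‖`, which the gain absorbs up to `ρ / 2 * ‖Z - W‖
^ 2` (`LossBounds.hasWeakLowerBound_of_lipschitz`). So the subgradients used by the algorithm are
weak subgradients of the loss, and the loss is directionally differentiable.

Kinks. This needs a gradient that is Lipschitz on the relevant products. Among the listed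
divergences only `ℓ₁` and `ℓ₂` lack it, and (for `F > 0`) they force `lam = 0`. Strong convexity
then excludes `ℓ₁` unless there is only one admissible `h`, in which case the loss is convex; for
`ℓ₂` it keeps `W h` away from `v` (`subsingleton_or_hasLipschitzGradient`).

Convergence. Let `φ(w)` be the minimum over `z ∈ C` of `f z + ρ / 2 * ‖z - w‖ ^ 2`. Inserting a
near-minimizer for `W t` into the descent inequality and integrating out the independent sample
gives `E φ(W (t+1)) ≤ E φ(W t) - ρ * η t * E (f - φ)(W t)` plus summable errors. Hence `∑ η t * (f -
φ)(W t)` is finite almost surely. The gap `f - φ` is Lipschitz and `W` moves by `O(η t)`, so the gap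
tends to zero. It vanishes only at points that minimize `f` plus a quadratic centred there, which
are critical; compactness finishes. The extended distance to the empty set is `⊤`, so the limit
includes the existence of critical points. -/

lemma tendsto_zero_of_summable_mul_of_slow {η a : ℕ → ℝ} {B : ℝ} (hη : ∀ t, 0 ≤ η t)
    (ha : ∀ t, 0 ≤ a t) (hη_zero : Tendsto η atTop (𝓝 0))
    (hdiv : Tendsto (fun n => ∑ t ∈ Finset.range n, η t) atTop atTop)
    (hsum : Summable fun t => η t * a t) (hB : 0 ≤ B)
    (hstep : ∀ t, a (t + 1) - a t ≤ B * η t) : Tendsto a atTop (𝓝 0) := by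
  suffices H : ∀ e > 0, ∀ᶠ t in atTop, a t ≤ 2 * e by
    rw [Metric.tendsto_atTop]
    intro e he
    obtain ⟨N, hN⟩ := eventually_atTop.1 (H (e / 4) (by positivity))
    refine ⟨N, fun n hn => ?_⟩
    rw [Real.dist_eq, sub_zero, abs_of_nonneg (ha n)]
    linarith [hN n hn]
  intro e he
  set S : ℕ → ℝ := fun n => ∑ t ∈ Finset.range n, η t * a t with hS
  have hSlim := hsum.hasSum.tendsto_sum_nat
  have hSle : ∀ n, S n ≤ ∑' t, η t * a t := fun n =>
    hsum.sum_le_tsum _ fun i _ => mul_nonneg (hη i) (ha i)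
  -- Beyond `N₁` the remaining sum, times `B / e`, is at most `e / 2`; beyond `N₂` a single step
  -- raises `a` by at most `e / 2`. Writing `B + 1` covers `B = 0`.
  have hc : 0 < e ^ 2 / (2 * (B + 1)) := by positivity
  obtain ⟨N₁, hN₁⟩ := eventually_atTop.1
    (hSlim.eventually (lt_mem_nhds (sub_lt_self (∑' t, η t * a t) hc)))
  obtain ⟨N₂, hN₂⟩ := eventually_atTop.1
    (hη_zero.eventually (gt_mem_nhds (show (0 : ℝ) < e / (2 * (B + 1)) by positivity)))
  -- Otherwise `η t ≤ η t * a t / e` from some index on, and `∑ η t` would be bounded.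
  have hfreq : ∃ t₀ ≥ max N₁ N₂, a t₀ < e := by
    by_contra! hcon
    have hbd : ∀ n, ∑ t ∈ Finset.range n, η t ≤
        ∑ t ∈ Finset.range (max N₁ N₂), η t + (∑' t, η t * a t) / e := by
      intro n
      have h1 : ∑ t ∈ Finset.range n, η t ≤
          ∑ t ∈ Finset.range (max N₁ N₂), η t + ∑ t ∈ Finset.range n, η t * a t / e := by
        induction n with
        | zero => simpa using Finset.sum_nonneg fun i _ => hη i
        | succ k ih =>
          by_cases hk : max N₁ N₂ ≤ k
          · rw [Finset.sum_range_succ, Finset.sum_range_succ]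
            have : η k ≤ η k * a k / e := by
              rw [le_div_iff₀ he]; exact mul_le_mul_of_nonneg_left (hcon k hk) (hη k)
            linarith
          · have h2 : ∑ t ∈ Finset.range (k + 1), η t ≤ ∑ t ∈ Finset.range (max N₁ N₂), η t :=
              Finset.sum_le_sum_of_subset_of_nonneg
                (Finset.range_subset_range.2 (by omega)) fun i _ _ => hη i
            have h3 : 0 ≤ ∑ t ∈ Finset.range (k + 1), η t * a t / e :=
              Finset.sum_nonneg fun i _ => div_nonneg (mul_nonneg (hη i) (ha i)) he.le
            linarith
      have h4 : ∑ t ∈ Finset.range n, η t * a t / e ≤ (∑' t, η t * a t) / e := by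
        rw [← Finset.sum_div]; exact div_le_div_of_nonneg_right (hSle n) he.le
      linarith
    obtain ⟨n, hn⟩ := (hdiv.eventually (eventually_gt_atTop _)).exists
    exact absurd (hbd n) (not_le.2 hn)
  obtain ⟨t₀, ht₀, hat₀⟩ := hfreq
  -- From below `e`, one step reaches at most `3 / 2 * e`. Above `e`, the increment `B * η t` is at
  -- most `B / e * (η t * a t)` and is charged to the growth of `S`.
  have key : ∀ t ≥ t₀, a t ≤ 3 / 2 * e + B / e * (S t - S t₀) := by
    intro t ht
    induction t, ht using Nat.le_induction with
    | base => linarith [show B / e * (S t₀ - S t₀) = 0 by ring]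
    | succ t ht ih =>
      have hSs : S (t + 1) = S t + η t * a t := Finset.sum_range_succ _ _
      have hmono : S t₀ ≤ S t := Finset.sum_le_sum_of_subset_of_nonneg
        (Finset.range_subset_range.2 ht) fun i _ _ => mul_nonneg (hη i) (ha i)
      have hBe : 0 ≤ B / e := by positivity
      by_cases hat : a t < e
      · have h1 : B * η t ≤ e / 2 := by
          have h2 := (hN₂ t (le_trans (le_trans (le_max_right _ _) ht₀) ht)).le
          calc B * η t ≤ (B + 1) * (e / (2 * (B + 1))) := by
                apply mul_le_mul _ h2 (hη t) (by positivity); linarith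
            _ = e / 2 := by field_simp
        have h3 : 0 ≤ B / e * (S (t + 1) - S t₀) :=
          mul_nonneg hBe (by rw [hSs]; linarith [mul_nonneg (hη t) (ha t)])
        linarith [hstep t]
      · push Not at hat
        have h1 : B * η t ≤ B / e * (η t * a t) := by
          rw [div_mul_eq_mul_div, le_div_iff₀ he, mul_assoc]
          exact mul_le_mul_of_nonneg_left (mul_le_mul_of_nonneg_left hat (hη t)) hB
        rw [hSs]
        have := hstep t
        linarith [show B / e * (S t + η t * a t - S t₀)
          = B / e * (S t - S t₀) + B / e * (η t * a t) by ring]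
  refine eventually_atTop.2 ⟨t₀, fun t ht => (key t ht).trans ?_⟩
  have h1 : S t - S t₀ ≤ e ^ 2 / (2 * (B + 1)) := by
    have := hN₁ t₀ (le_trans (le_max_left _ _) ht₀)
    have := hSle t
    simp only [hS] at *
    linarith
  have h2 : B / e * (S t - S t₀) ≤ e / 2 := by
    calc B / e * (S t - S t₀) ≤ (B + 1) / e * (e ^ 2 / (2 * (B + 1))) := by
          apply (mul_le_mul_of_nonneg_left h1 (by positivity)).trans
          gcongr; linarith
      _ = e / 2 := by field_simp
  linarith

/-! ### Auxiliary facts: infima over compact sets, measurable near-minimizers, independence -/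

lemma sInf_image_le {α : Type*} [TopologicalSpace α] {C : Set α} (hC : IsCompact C) {q : α → ℝ}
    (hq : ContinuousOn q C) {z : α} (hz : z ∈ C) : sInf (q '' C) ≤ q z :=
  csInf_le (hC.image_of_continuousOn hq).bddBelow (Set.mem_image_of_mem q hz)

/-- Allowing the error `e` makes near-minimality an open condition, so some point of a dense
sequence of `C` satisfies it; choosing the first such index is measurable in `w`. -/
lemma exists_measurable_near_minimizer {E : Type*} [TopologicalSpace E]
    [SecondCountableTopology E] [MeasurableSpace E] [OpensMeasurableSpace E] {C : Set E}
    (hC : IsCompact C) (hne : C.Nonempty) {q : E → E → ℝ}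
    (hq : Continuous (Function.uncurry q)) {e : ℝ} (he : 0 < e) :
    ∃ s : E → E, Measurable s ∧ ∀ w, s w ∈ C ∧ q w (s w) ≤ sInf (q w '' C) + e := by
  classical
  have : Nonempty C := hne.to_subtype
  have hinf : Continuous fun w => sInf (q w '' C) := hC.continuous_sInf hq
  have hqw : ∀ w, Continuous (q w) := fun w => hq.comp (by fun_prop : Continuous fun z => (w, z))
  have hqz : ∀ z, Continuous fun w => q w z := fun z =>
    hq.comp (by fun_prop : Continuous fun w => (w, z))
  have hex : ∀ w, ∃ n, q w (TopologicalSpace.denseSeq C n) < sInf (q w '' C) + e := by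
    intro w
    obtain ⟨z, hz, hze⟩ := hC.exists_isMinOn hne (hqw w).continuousOn
    have hzinf : q w z ≤ sInf (q w '' C) :=
      le_csInf (hne.image _) (by rintro _ ⟨y, hy, rfl⟩; exact hze hy)
    have hopen : IsOpen {y : C | q w y < sInf (q w '' C) + e} :=
      isOpen_lt ((hqw w).comp continuous_subtype_val) continuous_const
    obtain ⟨_, hy, n, rfl⟩ := (TopologicalSpace.denseRange_denseSeq C).inter_open_nonempty
      _ hopen ⟨⟨z, hz⟩, by simp only [Set.mem_ofPred_eq]; linarith⟩
    exact ⟨n, hy⟩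
  refine ⟨fun w => TopologicalSpace.denseSeq C (Nat.find (hex w)), ?_, fun w => ⟨Subtype.coe_prop _,
    (Nat.find_spec (hex w)).le⟩⟩
  have hmeas : Measurable fun w => Nat.find (hex w) := measurable_find hex fun k =>
    (isOpen_lt (hqz _) (hinf.add continuous_const)).measurableSet
  exact (measurable_from_nat (f := fun n => (TopologicalSpace.denseSeq C n : E))).comp hmeas

/-- The joint law is a product, so Fubini integrates `v` out with `w` frozen. This does the work of
conditioning on the past. -/
lemma integral_comp_of_indepFun {Ω X Y : Type*} [MeasurableSpace Ω] [MeasurableSpace X]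
    [MeasurableSpace Y] {μ : Measure Ω} [IsProbabilityMeasure μ] {P : Measure X}
    {v : Ω → X} {w : Ω → Y} (hv : Measurable v) (hw : Measurable w) (hlaw : μ.map v = P)
    (hind : IndepFun v w μ) {ψ : X → Y → ℝ} (hψ : Measurable (Function.uncurry ψ)) {M : ℝ}
    (hM : ∀ x y, |ψ x y| ≤ M) :
    ∫ ω, ψ (v ω) (w ω) ∂μ = ∫ ω, (∫ x, ψ x (w ω) ∂P) ∂μ := by
  have : IsProbabilityMeasure (μ.map v) := Measure.isProbabilityMeasure_map hv.aemeasurable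
  have : IsProbabilityMeasure (μ.map w) := Measure.isProbabilityMeasure_map hw.aemeasurable
  have hprod := hind.map_prod_eq_prod_map_map hv.aemeasurable hw.aemeasurable
  have h1 : ∫ ω, ψ (v ω) (w ω) ∂μ
      = ∫ p, Function.uncurry ψ p ∂(μ.map fun ω => (v ω, w ω)) :=
    (integral_map (hv.prodMk hw).aemeasurable hψ.aestronglyMeasurable).symm
  have hint : Integrable (Function.uncurry ψ) ((μ.map v).prod (μ.map w)) :=
    Integrable.of_bound hψ.aestronglyMeasurable M (ae_of_all _ fun p => hM p.1 p.2)
  have hm2 : StronglyMeasurable fun y => ∫ x, ψ x y ∂(μ.map v) :=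
    (hψ.stronglyMeasurable.comp_measurable measurable_swap).integral_prod_right'
  rw [h1, hprod, integral_prod_symm _ hint, ← hlaw]
  exact integral_map hw.aemeasurable hm2.aestronglyMeasurable

/-- By Tonelli the total sum has finite expectation, hence is finite almost everywhere. -/
lemma ae_summable_of_summable_integral {Ω : Type*} [MeasurableSpace Ω] {μ : Measure Ω}
    {a : ℕ → Ω → ℝ} (ha : ∀ t, ∀ᵐ ω ∂μ, 0 ≤ a t ω) (hint : ∀ t, Integrable (a t) μ)
    (hsum : Summable fun t => ∫ ω, a t ω ∂μ) : ∀ᵐ ω ∂μ, Summable fun t => a t ω := by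
  have h1 : ∫⁻ ω, ∑' t, ENNReal.ofReal (a t ω) ∂μ ≠ ⊤ := by
    rw [lintegral_tsum fun t => (hint t).aestronglyMeasurable.aemeasurable.ennreal_ofReal]
    simp_rw [← ofReal_integral_eq_lintegral_ofReal (hint _) (ha _)]
    rw [← ENNReal.ofReal_tsum_of_nonneg (fun t => integral_nonneg_of_ae (ha t)) hsum]
    exact ENNReal.ofReal_ne_top
  have h2 := ae_lt_top' (AEMeasurable.tsum fun t =>
    (hint t).aestronglyMeasurable.aemeasurable.ennreal_ofReal) h1
  filter_upwards [h2, ae_all_iff.2 ha] with ω hω hnn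
  have := ENNReal.summable_toReal hω.ne
  simpa [ENNReal.toReal_ofReal (hnn _)] using this

/-! ### Projected stochastic subgradient steps for a weakly convex expected loss -/

section Descent

variable {E : Type*} [NormedAddCommGroup E]

/-- The Moreau envelope of `f` relative to `C`. -/
noncomputable def moreauEnv (C : Set E) (ρ : ℝ) (f : E → ℝ) (w : E) : ℝ :=
  sInf ((fun z => f z + ρ / 2 * ‖z - w‖ ^ 2) '' C)

lemma continuous_moreauEnv {C : Set E} (hC : IsCompact C) (ρ : ℝ) {f : E → ℝ}
    (hf : Continuous f) : Continuous (moreauEnv C ρ f) := by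
  refine hC.continuous_sInf (f := fun w z => f z + ρ / 2 * ‖z - w‖ ^ 2) ?_
  simp only [Function.HasUncurry.uncurry, id]
  fun_prop

lemma moreauEnv_le {C : Set E} (hC : IsCompact C) (ρ : ℝ) {f : E → ℝ}
    (hf : Continuous f) (w : E) {z : E} (hz : z ∈ C) :
    moreauEnv C ρ f w ≤ f z + ρ / 2 * ‖z - w‖ ^ 2 :=
  sInf_image_le hC (q := fun z => f z + ρ / 2 * ‖z - w‖ ^ 2) (by fun_prop) hz

lemma moreauEnv_le_self {C : Set E} (hC : IsCompact C) (ρ : ℝ) {f : E → ℝ}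
    (hf : Continuous f) {w : E} (hw : w ∈ C) : moreauEnv C ρ f w ≤ f w := by
  simpa using moreauEnv_le hC ρ hf w hw

/-- The minimizer for `w'` competes at `w`, so only the two quadratic terms differ, and on a set of
diameter at most `R` these are Lipschitz in the centre. -/
lemma moreauEnv_sub_le {C : Set E} (hC : IsCompact C) {ρ : ℝ} (hρ : 0 ≤ ρ) {f : E → ℝ}
    (hf : Continuous f) {R : ℝ} (hR : ∀ x ∈ C, ∀ y ∈ C, ‖x - y‖ ≤ R) {w w' : E} (hw : w ∈ C)
    (hw' : w' ∈ C) : moreauEnv C ρ f w - moreauEnv C ρ f w' ≤ ρ * R * ‖w - w'‖ := by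
  obtain ⟨z, hz, hmin⟩ := hC.exists_isMinOn (f := fun z => f z + ρ / 2 * ‖z - w'‖ ^ 2) ⟨w, hw⟩
    (by fun_prop)
  have h1 : f z + ρ / 2 * ‖z - w'‖ ^ 2 ≤ moreauEnv C ρ f w' :=
    le_csInf (Set.Nonempty.image _ ⟨w, hw⟩) (by rintro _ ⟨y, hy, rfl⟩; exact hmin hy)
  have h2 := moreauEnv_le hC ρ hf w hz
  have h3 : ‖z - w‖ ≤ ‖z - w'‖ + ‖w - w'‖ := by
    calc ‖z - w‖ = ‖(z - w') - (w - w')‖ := by congr 1; abel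
      _ ≤ _ := norm_sub_le _ _
  have h4 : ‖z - w‖ ^ 2 - ‖z - w'‖ ^ 2 ≤ 2 * R * ‖w - w'‖ := by
    rw [sq_sub_sq]
    have ha := hR z hz w hw
    have hb := hR z hz w' hw'
    have h5 : (‖z - w‖ + ‖z - w'‖) * (‖z - w‖ - ‖z - w'‖)
        ≤ (‖z - w‖ + ‖z - w'‖) * ‖w - w'‖ :=
      mul_le_mul_of_nonneg_left (by linarith) (by positivity)
    exact h5.trans (mul_le_mul_of_nonneg_right (by linarith) (norm_nonneg _))
  have h6 := mul_le_mul_of_nonneg_left h4 (show 0 ≤ ρ / 2 by linarith)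
  linarith

end Descent

lemma continuous_integral_loss {E X : Type*} [NormedAddCommGroup E] [TopologicalSpace X]
    [MeasurableSpace X] [BorelSpace X] {P : Measure X} [IsProbabilityMeasure P] {l : X → E → ℝ}
    (hl : Continuous (Function.uncurry l)) {M : ℝ}
    (hM : ∀ x z, |l x z| ≤ M) : Continuous fun z => ∫ x, l x z ∂P := by
  refine continuous_of_dominated (bound := fun _ => M) (fun z => ?_) (fun z => ae_of_all _ fun x =>
    hM x z) (integrable_const M) (ae_of_all _ fun x => ?_)
  · exact (hl.comp (by fun_prop : Continuous fun x => (x, z))).measurable.aestronglyMeasurable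
  · exact hl.comp (by fun_prop : Continuous fun z => (x, z))

section Stochastic

variable {E : Type*} [NormedAddCommGroup E] [MeasurableSpace E] [BorelSpace E]
  [SecondCountableTopology E] {X : Type*} [TopologicalSpace X] [MeasurableSpace X] [BorelSpace X]
  {Ω : Type*} [MeasurableSpace Ω] {μ : Measure Ω} [IsProbabilityMeasure μ]
  {P : Measure X} [IsProbabilityMeasure P]

/-- If the iterates satisfy the descent inequality of a projected stochastic subgradient method
for a loss with weak subgradients, the expected Moreau gap decreases in expectation. -/
lemma integral_moreauEnv_step {l : X → E → ℝ} (hl : Continuous (Function.uncurry l)) {M : ℝ}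
    (hM : ∀ x z, |l x z| ≤ M) {C : Set E} (hC : IsCompact C) (hne : C.Nonempty)
    {ρ B η e : ℝ} (hρ : 0 ≤ ρ) (hη : 0 ≤ η) (he : 0 < e)
    {v : Ω → X} {w w' : Ω → E} (hv : Measurable v) (hw : Measurable w) (hw' : Measurable w')
    (hlaw : μ.map v = P) (hind : IndepFun v w μ) (hwC : ∀ᵐ ω ∂μ, w ω ∈ C)
    (hwC' : ∀ᵐ ω ∂μ, w' ω ∈ C)
    (hdesc : ∀ᵐ ω ∂μ, ∀ z ∈ C, ‖z - w' ω‖ ^ 2 ≤ ‖z - w ω‖ ^ 2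
      + 2 * η * (l (v ω) z - l (v ω) (w ω) + ρ / 2 * ‖z - w ω‖ ^ 2) + B ^ 2 * η ^ 2) :
    let f := fun z => ∫ x, l x z ∂P
    Integrable (fun ω => f (w ω) - moreauEnv C ρ f (w ω)) μ ∧
    ρ * (η * ∫ ω, (f (w ω) - moreauEnv C ρ f (w ω)) ∂μ) ≤
      ∫ ω, moreauEnv C ρ f (w ω) ∂μ - ∫ ω, moreauEnv C ρ f (w' ω) ∂μ
        + e * (1 + ρ * η) + ρ / 2 * B ^ 2 * η ^ 2 := by
  intro f
  have hf : Continuous f := continuous_integral_loss hl hM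
  have hφ : Continuous (moreauEnv C ρ f) := continuous_moreauEnv hC ρ hf
  have hbdd : ∀ {u : Ω → E} {q : E → ℝ}, Measurable u → (∀ᵐ ω ∂μ, u ω ∈ C) → Continuous q →
      Integrable (fun ω => q (u ω)) μ := by
    intro u q hu huC hq
    obtain ⟨c, hc⟩ := hC.exists_bound_of_continuousOn hq.continuousOn
    exact Integrable.of_bound (hq.measurable.comp hu).aestronglyMeasurable c
      (huC.mono fun ω h => hc _ h)
  have hD : Integrable (fun ω => f (w ω) - moreauEnv C ρ f (w ω)) μ :=
    hbdd hw hwC (hf.sub hφ)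
  refine ⟨hD, ?_⟩
  obtain ⟨s, hs, hsmin⟩ := exists_measurable_near_minimizer hC hne
    (q := fun w z => f z + ρ / 2 * ‖z - w‖ ^ 2) (show Continuous fun p : E × E => f p.2 + ρ / 2 * ‖p.2 - p.1‖ ^ 2 by fun_prop) he
  -- The competitor `s (w ω)` depends on `w` alone, so independence applies to `ψ (v ω) (w ω)`.
  set ψ : X → E → ℝ := fun x y => l x (s y) - l x y with hψdef
  have hψm : Measurable (Function.uncurry ψ) := by
    have h1 : Measurable fun p : X × E => l p.1 (s p.2) :=
      hl.measurable.comp (by fun_prop : Measurable fun p : X × E => (p.1, s p.2))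
    exact h1.sub hl.measurable
  have hψb : ∀ x y, |ψ x y| ≤ M + M := fun x y =>
    (abs_sub _ _).trans (add_le_add (hM _ _) (hM _ _))
  have hli : ∀ z, Integrable (fun x => l x z) P := fun z =>
    Integrable.of_bound (hl.comp (by fun_prop : Continuous fun x =>
      (x, z))).measurable.aestronglyMeasurable M (ae_of_all _ fun x => hM x z)
  have hψE : ∫ ω, ψ (v ω) (w ω) ∂μ = ∫ ω, (f (s (w ω)) - f (w ω)) ∂μ := by
    rw [integral_comp_of_indepFun hv hw hlaw hind hψm hψb]
    congr 1
    ext ω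
    exact integral_sub (hli _) (hli _)
  have hψi : Integrable (fun ω => ψ (v ω) (w ω)) μ :=
    Integrable.of_bound (hψm.comp (hv.prodMk hw)).aestronglyMeasurable (M + M)
      (ae_of_all _ fun ω => hψb _ _)
  have hfi : Integrable (fun ω => f (s (w ω)) - f (w ω)) μ := by
    refine Integrable.of_bound ((hf.measurable.comp (hs.comp hw)).sub
      (hf.measurable.comp hw)).aestronglyMeasurable (M + M) (ae_of_all _ fun ω => ?_)
    have hfM : ∀ z, |f z| ≤ M := fun z => by
      have := norm_integral_le_of_norm_le_const (μ := P) (f := fun x => l x z) (C := M)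
        (ae_of_all _ fun x => hM x z)
      simpa using this
    exact (abs_sub _ _).trans (add_le_add (hfM _) (hfM _))
  -- The second term is noise with mean zero by `hψE`. The error `e` enters twice: in the envelope
  -- at `w`, and, times `ρ * η`, in the gap.
  have hpt : ∀ᵐ ω ∂μ, moreauEnv C ρ f (w' ω) ≤ moreauEnv C ρ f (w ω)
      + ρ * η * (ψ (v ω) (w ω) - (f (s (w ω)) - f (w ω)))
      - ρ * η * (f (w ω) - moreauEnv C ρ f (w ω))
      + (e * (1 + ρ * η) + ρ / 2 * B ^ 2 * η ^ 2) := by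
    filter_upwards [hdesc] with ω hω
    obtain ⟨hz, hze⟩ := hsmin (w ω)
    have h1 := moreauEnv_le hC ρ hf (w' ω) hz
    have h2 := mul_le_mul_of_nonneg_left (hω _ hz) (show 0 ≤ ρ / 2 by linarith)
    change f (s (w ω)) + ρ / 2 * ‖s (w ω) - w ω‖ ^ 2 ≤ moreauEnv C ρ f (w ω) + e at hze
    have h3 := mul_le_mul_of_nonneg_left hze (mul_nonneg hρ hη)
    simp only [hψdef]
    nlinarith
  have hφi := hbdd hw hwC hφ
  have hφi' := hbdd hw' hwC' hφ
  have hi1 : Integrable (fun ω => ρ * η * (ψ (v ω) (w ω) - (f (s (w ω)) - f (w ω)))) μ :=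
    (hψi.sub hfi).const_mul _
  have hi2 : Integrable (fun ω => ρ * η * (f (w ω) - moreauEnv C ρ f (w ω))) μ :=
    hD.const_mul _
  have hi3 : Integrable (fun ω => moreauEnv C ρ f (w ω)
      + ρ * η * (ψ (v ω) (w ω) - (f (s (w ω)) - f (w ω)))) μ := hφi.add hi1
  have hi4 : Integrable (fun ω => moreauEnv C ρ f (w ω)
      + ρ * η * (ψ (v ω) (w ω) - (f (s (w ω)) - f (w ω)))
      - ρ * η * (f (w ω) - moreauEnv C ρ f (w ω))) μ := hi3.sub hi2
  have hmono := integral_mono_ae hφi' (hi4.add (integrable_const _)) hpt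
  simp only [Pi.add_apply] at hmono
  rw [integral_add hi4 (integrable_const _), integral_sub hi3 hi2, integral_add hφi hi1, integral_const_mul, integral_const_mul, integral_sub hψi hfi, hψE] at hmono
  simp only [integral_const, probReal_univ, one_smul, sub_self, mul_zero, add_zero] at hmono
  linarith [mul_assoc ρ η (∫ ω, (f (w ω) - moreauEnv C ρ f (w ω)) ∂μ)]

/-- Summing the one-step inequality telescopes the bounded expected envelopes, so the gaps weighted
by `η` are summable in expectation and thus almost surely. Along a path the gap grows by at most a
multiple of `η t` per step, and `tendsto_zero_of_summable_mul_of_slow` applies. -/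
theorem tendsto_moreau_gap {l : X → E → ℝ} (hl : Continuous (Function.uncurry l)) {M : ℝ}
    (hM : ∀ x z, |l x z| ≤ M) {C : Set E} (hC : IsCompact C) (hne : C.Nonempty)
    {ρ B L : ℝ} (hρ : 0 < ρ) (hB : 0 ≤ B) (hL : 0 ≤ L)
    (hlip : ∀ x ∈ C, ∀ y ∈ C, |∫ p, l p x ∂P - ∫ p, l p y ∂P| ≤ L * ‖x - y‖)
    {η : ℕ → ℝ} (hη0 : ∀ t, 0 ≤ η t)
    (hη1 : Tendsto (fun n => ∑ t ∈ Finset.range n, η t) atTop atTop)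
    (hη2 : Summable fun t => η t ^ 2)
    {v : ℕ → Ω → X} {W : ℕ → Ω → E} (hv : ∀ t, Measurable (v t)) (hW : ∀ t, Measurable (W t))
    (hlaw : ∀ t, μ.map (v t) = P) (hind : ∀ t, IndepFun (v t) (W t) μ)
    (hWC : ∀ t, ∀ᵐ ω ∂μ, W t ω ∈ C)
    (hstep : ∀ t, ∀ᵐ ω ∂μ, ‖W (t + 1) ω - W t ω‖ ≤ B * η t)
    (hdesc : ∀ t, ∀ᵐ ω ∂μ, ∀ z ∈ C, ‖z - W (t + 1) ω‖ ^ 2 ≤ ‖z - W t ω‖ ^ 2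
      + 2 * η t * (l (v t ω) z - l (v t ω) (W t ω) + ρ / 2 * ‖z - W t ω‖ ^ 2)
      + B ^ 2 * η t ^ 2) :
    ∀ᵐ ω ∂μ, Tendsto (fun t => ∫ x, l x (W t ω) ∂P
      - moreauEnv C ρ (fun z => ∫ x, l x z ∂P) (W t ω)) atTop (𝓝 0) := by
  set f : E → ℝ := fun z => ∫ x, l x z ∂P with hfdef
  have hf : Continuous f := continuous_integral_loss hl hM
  have hφ : Continuous (moreauEnv C ρ f) := continuous_moreauEnv hC ρ hf
  have hηlim : Tendsto η atTop (𝓝 0) := by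
    have h := hη2.tendsto_atTop_zero.sqrt
    simpa [Real.sqrt_sq (hη0 _)] using h
  obtain ⟨R, hR⟩ : ∃ R, ∀ x ∈ C, ∀ y ∈ C, ‖x - y‖ ≤ R := by
    obtain ⟨R, hR⟩ := Metric.isBounded_iff.1 hC.isBounded
    exact ⟨R, fun x hx y hy => by simpa [dist_eq_norm] using hR hx hy⟩
  have hR0 : 0 ≤ R := by
    obtain ⟨x, hx⟩ := hne
    simpa using hR x hx x hx
  -- With this precision the selection error `e t * (1 + ρ * η t)` is exactly `(1 / 2) ^ t`, which
  -- is summable.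
  set e : ℕ → ℝ := fun t => (1 / 2) ^ t / (1 + ρ * η t)
  have hepos : ∀ t, 0 < 1 + ρ * η t := fun t => by
    have := mul_nonneg hρ.le (hη0 t); linarith
  have hone := fun t => integral_moreauEnv_step hl hM hC hne (B := B) hρ.le (hη0 t)
    (show 0 < (1 / 2 : ℝ) ^ t / (1 + ρ * η t) from div_pos (by positivity) (hepos t))
    (hv t) (hW t) (hW (t + 1)) (hlaw t) (hind t) (hWC t) (hWC (t + 1)) (hdesc t)
  have hnn : ∀ t, ∀ᵐ ω ∂μ, 0 ≤ f (W t ω) - moreauEnv C ρ f (W t ω) := fun t =>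
    (hWC t).mono fun ω hω => sub_nonneg.2 (moreauEnv_le_self hC ρ hf hω)
  set D : ℕ → ℝ := fun t => ∫ ω, (f (W t ω) - moreauEnv C ρ f (W t ω)) ∂μ with hDdef
  have hDnn : ∀ t, 0 ≤ D t := fun t => integral_nonneg_of_ae (hnn t)
  obtain ⟨c, hc⟩ := hC.exists_bound_of_continuousOn hφ.continuousOn
  have hΦ : ∀ t, |∫ ω, moreauEnv C ρ f (W t ω) ∂μ| ≤ c := fun t => by
    have := norm_integral_le_of_norm_le_const (μ := μ) ((hWC t).mono fun ω hω => hc _ hω)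
    simpa using this
  have hgeo : Summable fun t : ℕ => (1 / 2 : ℝ) ^ t := summable_geometric_two
  have hpart : ∀ n, ∑ t ∈ Finset.range n, ρ * (η t * D t) ≤
      2 * c + ∑' t : ℕ, (1 / 2 : ℝ) ^ t + ρ / 2 * B ^ 2 * ∑' t, η t ^ 2 := by
    intro n
    have h1 : ∑ t ∈ Finset.range n, ρ * (η t * D t) ≤ ∑ t ∈ Finset.range n,
        ((∫ ω, moreauEnv C ρ f (W t ω) ∂μ - ∫ ω, moreauEnv C ρ f (W (t + 1) ω) ∂μ)
          + ((1 / 2 : ℝ) ^ t + ρ / 2 * B ^ 2 * η t ^ 2)) := by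
      refine Finset.sum_le_sum fun t _ => ?_
      have h := (hone t).2
      rw [div_mul_cancel₀ _ (hepos t).ne'] at h
      linarith
    rw [Finset.sum_add_distrib, Finset.sum_range_sub', Finset.sum_add_distrib] at h1
    have h2 := hgeo.sum_le_tsum (Finset.range n) fun i _ => by positivity
    have h3 := mul_le_mul_of_nonneg_left
      (hη2.sum_le_tsum (Finset.range n) fun i _ => by positivity)
      (show 0 ≤ ρ / 2 * B ^ 2 by positivity)
    rw [Finset.mul_sum] at h3
    have h4 := abs_le.1 (hΦ 0)
    have h5 := abs_le.1 (hΦ n)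
    linarith
  have hsum : Summable fun t => η t * D t := by
    have := summable_of_sum_range_le
      (fun t => mul_nonneg hρ.le (mul_nonneg (hη0 t) (hDnn t))) hpart
    exact (summable_mul_left_iff hρ.ne').1 this
  have hsumω := ae_summable_of_summable_integral
    (a := fun t ω => η t * (f (W t ω) - moreauEnv C ρ f (W t ω)))
    (fun t => (hnn t).mono fun ω h => mul_nonneg (hη0 t) h) (fun t => (hone t).1.const_mul _)
    (by simpa only [integral_const_mul] using hsum)
  filter_upwards [hsumω, ae_all_iff.2 hnn, ae_all_iff.2 hWC, ae_all_iff.2 hstep]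
    with ω hsω hnnω hCω hstω
  refine tendsto_zero_of_summable_mul_of_slow (B := (L + ρ * R) * B) hη0 hnnω hηlim hη1 hsω
    (by positivity) fun t => ?_
  have h1 := (abs_le.1 (hlip _ (hCω (t + 1)) _ (hCω t))).2
  have h2 := moreauEnv_sub_le hC hρ.le hf hR (hCω t) (hCω (t + 1))
  rw [norm_sub_rev] at h2
  have h3 := mul_le_mul_of_nonneg_left (hstω t) (show 0 ≤ L + ρ * R by positivity)
  linarith

end Stochastic

/-- A continuous nonnegative gap on a compact set that tends to zero along a sequence forces the
sequence to approach every set containing the zeros of the gap. -/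
lemma tendsto_infEDist_of_tendsto_gap {E : Type*} [PseudoEMetricSpace E] {C S : Set E}
    (hC : IsCompact C) {D : E → ℝ} (hD : ContinuousOn D C) (hD0 : ∀ x ∈ C, 0 ≤ D x)
    (hS : ∀ x ∈ C, D x = 0 → x ∈ S) {w : ℕ → E} (hw : ∀ t, w t ∈ C)
    (hlim : Tendsto (fun t => D (w t)) atTop (𝓝 0)) :
    Tendsto (fun t => Metric.infEDist (w t) S) atTop (𝓝 0) := by
  rw [ENNReal.tendsto_nhds_zero]
  intro e he
  -- On this compact set the gap has no zero, hence a positive minimum, so the sequence eventually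
  -- avoids it.
  set A : Set E := C ∩ {x | e ≤ Metric.infEDist x S}
  have hA : IsCompact A :=
    hC.inter_right (isClosed_le continuous_const Metric.continuous_infEDist)
  rcases A.eq_empty_or_nonempty with hAe | hAne
  · refine Eventually.of_forall fun t => ?_
    by_contra hcon
    exact (hAe ▸ (⟨hw t, (not_le.1 hcon).le⟩ : w t ∈ A) : w t ∈ (∅ : Set E))
  · obtain ⟨x, hx, hmin⟩ := hA.exists_isMinOn hAne (hD.mono Set.inter_subset_left)
    have hpos : 0 < D x := by
      refine lt_of_le_of_ne (hD0 x hx.1) fun h => ?_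
      have : e ≤ Metric.infEDist x S := hx.2
      rw [Metric.infEDist_zero_of_mem (hS x hx.1 h.symm)] at this
      exact absurd this (not_le.2 he)
    filter_upwards [hlim.eventually (gt_mem_nhds hpos)] with t ht
    by_contra hcon
    exact absurd (hmin (⟨hw t, (not_le.1 hcon).le⟩ : w t ∈ A)) (not_le.2 ht)

/-! ### One-sided directional derivatives of convex functions -/

section DirDeriv

variable {E : Type*} [NormedAddCommGroup E] [InnerProductSpace ℝ E]

lemma HasDirDeriv.unique {f : E → ℝ} {x u : E} {D D' : ℝ} (h : HasDirDeriv f x u D)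
    (h' : HasDirDeriv f x u D') : D = D' :=
  tendsto_nhds_unique h h'

lemma HasDirDeriv.smul {f : E → ℝ} {x u : E} {D : ℝ} (h : HasDirDeriv f x u D) {c : ℝ}
    (hc : 0 < c) : HasDirDeriv f x (c • u) (c * D) := by
  have h1 : Tendsto (fun δ : ℝ => δ * c) (𝓝[>] 0) (𝓝[>] 0) := by
    refine tendsto_nhdsWithin_iff.2 ⟨?_, ?_⟩
    · refine (Continuous.tendsto' (by fun_prop) 0 0 (by simp)).mono_left nhdsWithin_le_nhds
    · filter_upwards [self_mem_nhdsWithin] with δ hδ using mul_pos hδ hc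
  refine ((h.comp h1).const_mul c).congr fun δ => ?_
  simp only [Function.comp_apply, smul_smul]
  rw [mul_div_assoc', mul_div_mul_comm, mul_comm δ c]
  rcases eq_or_ne δ 0 with rfl | hδ
  · simp
  · field_simp

lemma HasDirDeriv.congr_of_eventuallyEq {f g : E → ℝ} {x u : E} {D : ℝ} (h : HasDirDeriv f x u D)
    (hfg : f =ᶠ[𝓝 x] g) : HasDirDeriv g x u D := by
  have h1 : Tendsto (fun δ : ℝ => x + δ • u) (𝓝[>] 0) (𝓝 x) :=
    (Continuous.tendsto' (by fun_prop) 0 x (by simp)).mono_left nhdsWithin_le_nhds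
  refine Tendsto.congr' ?_ h
  filter_upwards [h1.eventually hfg] with δ hδ
  rw [hδ, hfg.eq_of_nhds]

lemma inner_le_of_mem_frechetSubdifferential {f : E → ℝ} {x u g : E} {D : ℝ}
    (hg : g ∈ frechetSubdifferential f x) (h : HasDirDeriv f x u D) : inner ℝ g u ≤ D := by
  refine le_of_forall_pos_le_add fun c hc => ?_
  -- This tolerance, times `‖u‖`, is at most `c`, also when `u = 0`.
  have hc' : 0 < c / (‖u‖ + 1) := by positivity
  have h1 : Tendsto (fun δ : ℝ => x + δ • u) (𝓝[>] 0) (𝓝 x) :=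
    (Continuous.tendsto' (by fun_prop) 0 x (by simp)).mono_left nhdsWithin_le_nhds
  have h2 : ∀ᶠ δ : ℝ in 𝓝[>] 0, inner ℝ g u - c ≤ (f (x + δ • u) - f x) / δ := by
    filter_upwards [h1.eventually (hg _ hc'), self_mem_nhdsWithin] with δ hδ hpos
    have hpos : 0 < δ := hpos
    rw [add_sub_cancel_left, inner_smul_right, norm_smul, Real.norm_of_nonneg hpos.le] at hδ
    rw [le_div_iff₀ hpos]
    have h3 : c / (‖u‖ + 1) * ‖u‖ ≤ c := by
      rw [div_mul_eq_mul_div, div_le_iff₀ (by positivity)]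
      nlinarith [norm_nonneg u]
    nlinarith [mul_le_mul_of_nonneg_left h3 hpos.le]
  linarith [ge_of_tendsto h h2]

variable {O : Set E} {f : E → ℝ}

lemma exists_hasDirDeriv_of_convexOn (hf : ConvexOn ℝ O f) (hO : IsOpen O) {x : E} (hx : x ∈ O)
    (u : E) : ∃ D, HasDirDeriv f x u D := by
  set A : ℝ →ᵃ[ℝ] E := AffineMap.lineMap x (x + u)
  have hA : ∀ t, A t = x + t • u := fun t => by
    simp [A, AffineMap.lineMap_apply, add_comm]
  have hconv : ConvexOn ℝ (A ⁻¹' O) (f ∘ A) := hf.comp_affineMap A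
  have hcont : Continuous A := by
    have : (A : ℝ → E) = fun t => x + t • u := funext hA
    rw [this]; fun_prop
  have h0 : (0 : ℝ) ∈ interior (A ⁻¹' O) := by
    rw [(hO.preimage hcont).interior_eq]; simpa [hA] using hx
  have h := (hasDerivWithinAt_iff_tendsto_slope' (by simp)).1
    (hconv.hasDerivWithinAt_sInf_slope_of_mem_interior h0)
  refine ⟨_, h.congr fun δ => ?_⟩
  simp [slope_def_field, hA]

lemma HasDirDeriv.le_sub_of_convexOn (hf : ConvexOn ℝ O f) {x z : E} (hx : x ∈ O) (hz : z ∈ O)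
    {D : ℝ} (h : HasDirDeriv f x (z - x) D) : D ≤ f z - f x := by
  refine le_of_tendsto h ?_
  filter_upwards [Ioo_mem_nhdsGT (zero_lt_one' ℝ)] with δ hδ
  rw [div_le_iff₀ hδ.1]
  have h1 := hf.2 hx hz (sub_nonneg.2 hδ.2.le) hδ.1.le (by ring)
  rw [show (1 - δ) • x + δ • z = x + δ • (z - x) by module] at h1
  simp only [smul_eq_mul] at h1
  linarith

/-- Rescale `u` to length `r`: the derivative in that direction is at most an increment of `f`
inside the ball, hence at most `2 * M`. -/
lemma HasDirDeriv.le_of_convexOn_of_bound (hf : ConvexOn ℝ O f) {x u : E} {M r : ℝ} (hr : 0 < r)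
    (hO : Metric.closedBall x r ⊆ O) (hM : ∀ y ∈ Metric.closedBall x r, |f y| ≤ M) {D : ℝ}
    (h : HasDirDeriv f x u D) : D ≤ 2 * M / r * ‖u‖ := by
  rcases eq_or_ne u 0 with rfl | hu
  · have h0 : HasDirDeriv f x (0 : E) 0 := by simp [HasDirDeriv]
    simp [h.unique h0]
  · have hu' : 0 < ‖u‖ := norm_pos_iff.2 hu
    have hxb : x ∈ Metric.closedBall x r := Metric.mem_closedBall_self hr.le
    have hyb : x + (r / ‖u‖) • u ∈ Metric.closedBall x r := by
      rw [mem_closedBall_iff_norm, add_sub_cancel_left, norm_smul, Real.norm_of_nonneg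
        (by positivity), div_mul_cancel₀ _ hu'.ne']
    have h1 := h.smul (c := r / ‖u‖) (by positivity)
    rw [show (r / ‖u‖) • u = x + (r / ‖u‖) • u - x by abel] at h1
    have h2 := h1.le_sub_of_convexOn hf (hO hxb) (hO hyb)
    have h3 := abs_le.1 (hM _ hxb)
    have h4 := abs_le.1 (hM _ hyb)
    have h5 : r / ‖u‖ * D ≤ 2 * M := by linarith
    rw [div_mul_eq_mul_div, le_div_iff₀ hr]
    rw [div_mul_eq_mul_div, div_le_iff₀ hu'] at h5
    linarith

/-- Prolong the segment from `y` through `x` by length `r`; then `x` is a convex combination of `y`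
and a point of the sphere. The point `y` may lie outside the ball. -/
lemma sub_le_of_convexOn_of_bound (hf : ConvexOn ℝ O f) {x y : E} {M r : ℝ} (hr : 0 < r)
    (hO : Metric.closedBall x r ⊆ O) (hM : ∀ y ∈ Metric.closedBall x r, |f y| ≤ M)
    (hy : y ∈ O) (hyM : |f y| ≤ M) : f x - f y ≤ 2 * M / r * ‖x - y‖ := by
  rcases eq_or_ne x y with rfl | hxy
  · simp
  have hn : 0 < ‖x - y‖ := norm_pos_iff.2 (sub_ne_zero.2 hxy)
  set c := r / ‖x - y‖ with hc
  have hcpos : 0 < c := by positivity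
  have hzb : x + c • (x - y) ∈ Metric.closedBall x r := by
    rw [mem_closedBall_iff_norm, add_sub_cancel_left, norm_smul, Real.norm_of_nonneg
      hcpos.le, div_mul_cancel₀ _ hn.ne']
  have h1 := hf.2 hy (hO hzb) (show 0 ≤ c / (c + 1) by positivity)
    (show 0 ≤ 1 / (c + 1) by positivity) (by field_simp)
  have h2 : (c / (c + 1)) • y + (1 / (c + 1)) • (x + c • (x - y)) = x := by
    match_scalars <;> field_simp <;> ring
  rw [h2, smul_eq_mul, smul_eq_mul] at h1
  have h3 := abs_le.1 (hM _ hzb)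
  have h4 := abs_le.1 hyM
  have h5 : f x - f y ≤ 1 / (c + 1) * (2 * M) := by
    have : c / (c + 1) = 1 - 1 / (c + 1) := by field_simp; ring
    rw [this] at h1
    have : 1 / (c + 1) * (f (x + c • (x - y)) - f y) ≤ 1 / (c + 1) * (2 * M) :=
      mul_le_mul_of_nonneg_left (by linarith) (by positivity)
    linarith
  have hM0 : 0 ≤ M := (abs_nonneg _).trans hyM
  have h6 : 1 / (c + 1) ≤ ‖x - y‖ / r := by
    have : ‖x - y‖ / r = 1 / c := by rw [hc]; field_simp
    rw [this]
    exact one_div_le_one_div_of_le hcpos (by linarith)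
  calc f x - f y ≤ 1 / (c + 1) * (2 * M) := h5
    _ ≤ ‖x - y‖ / r * (2 * M) := mul_le_mul_of_nonneg_right h6 (by positivity)
    _ = _ := by ring

lemma isMinOn_of_mem_criticalPoints {S : Set E} (hf : ConvexOn ℝ S f) {x : E}
    (hx : x ∈ criticalPoints f S) : x ∈ S ∧ IsMinOn f S x := by
  refine ⟨hx.1, fun y hy => ?_⟩
  obtain ⟨D, hD, hD0⟩ := hx.2 y hy
  have := hD.le_sub_of_convexOn hf hx.1 hy
  simp only [Set.mem_ofPred_eq]
  linarith

/-- Compare `x` with the point at fraction `b` towards `y`; dividing by `b` leaves the factor `1 -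
b`, which tends to `1`. -/
lemma quadratic_growth_of_strongConvexOn {S : Set E} {m : ℝ} (hf : StrongConvexOn S m f) {x y : E}
    (hx : x ∈ S) (hmin : IsMinOn f S x) (hy : y ∈ S) :
    m / 2 * ‖y - x‖ ^ 2 ≤ f y - f x := by
  have h1 : ∀ᶠ b : ℝ in 𝓝[>] 0, (1 - b) * (m / 2 * ‖y - x‖ ^ 2) ≤ f y - f x := by
    filter_upwards [Ioo_mem_nhdsGT (zero_lt_one' ℝ)] with b hb
    have ha : 0 ≤ 1 - b := by linarith [hb.2]
    have h2 := hf.2 hx hy ha hb.1.le (by ring)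
    have h3 : f x ≤ f ((1 - b) • x + b • y) := hmin (hf.1 hx hy ha hb.1.le (by ring))
    simp only [smul_eq_mul] at h2
    rw [norm_sub_rev] at h2
    have h4 : b * ((1 - b) * (m / 2 * ‖y - x‖ ^ 2)) ≤ b * (f y - f x) := by linarith
    exact le_of_mul_le_mul_left h4 hb.1
  refine le_of_tendsto ?_ h1
  refine (Continuous.tendsto' (by fun_prop) 0 _ (by ring)).mono_left nhdsWithin_le_nhds

end DirDeriv

/-! ### The matrix-vector product and the constraint sets -/

section MulVec

variable {F K : ℕ}

@[simp] lemma mulVec_apply (W : Mat F K) (h : Vec K) (i : Fin F) :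
    mulVec W h i = ∑ j, W (i, j) * h j := rfl

lemma mulVec_add_smul (W U : Mat F K) (δ : ℝ) (h : Vec K) :
    mulVec (W + δ • U) h = mulVec W h + δ • mulVec U h := by
  ext i
  simp [add_mul, Finset.sum_add_distrib, Finset.mul_sum, mul_assoc]

lemma mulVec_sub_left (W U : Mat F K) (h : Vec K) :
    mulVec (W - U) h = mulVec W h - mulVec U h := by
  ext i; simp [sub_mul]

lemma mulVec_sub_right (W : Mat F K) (h k : Vec K) :
    mulVec W (h - k) = mulVec W h - mulVec W k := by
  ext i; simp [mul_sub]

lemma norm_mulVec_le (W : Mat F K) (h : Vec K) : ‖mulVec W h‖ ≤ ‖W‖ * ‖h‖ := by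
  refine le_of_sq_le_sq ?_ (by positivity)
  rw [mul_pow, EuclideanSpace.real_norm_sq_eq, EuclideanSpace.real_norm_sq_eq,
    EuclideanSpace.real_norm_sq_eq, Fintype.sum_prod_type, Finset.sum_mul]
  refine Finset.sum_le_sum fun i _ => ?_
  rw [mulVec_apply]
  exact Finset.sum_mul_sq_le_sq_mul_sq _ _ _

lemma continuous_mulVec : Continuous fun p : Mat F K × Vec K => mulVec p.1 p.2 := by
  unfold mulVec
  fun_prop

lemma isOpen_posOrthant (n : ℕ) : IsOpen (posOrthant n) := by
  have : posOrthant n = ⋂ i, {x : Vec n | 0 < x i} := by ext; simp [posOrthant]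
  rw [this]
  exact isOpen_iInter_of_finite fun i => isOpen_lt continuous_const (by fun_prop)

lemma isCompact_of_isClosed_of_coord_bound {ι : Type*} [Fintype ι] {S : Set (EuclideanSpace ℝ ι)}
    (hS : IsClosed S) {R : ℝ} (hR : ∀ x ∈ S, ∀ i, |x i| ≤ R) : IsCompact S := by
  refine Metric.isCompact_of_isClosed_isBounded hS ?_
  refine (Metric.isBounded_closedBall (x := (0 : EuclideanSpace ℝ ι))
    (r := Real.sqrt (∑ _i : ι, R ^ 2))).subset fun x hx => ?_
  rw [mem_closedBall_zero_iff, EuclideanSpace.norm_eq]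
  refine Real.sqrt_le_sqrt (Finset.sum_le_sum fun i _ => ?_)
  exact pow_le_pow_left₀ (norm_nonneg _) (hR x hx i) 2

lemma isCompact_coefSet (K : ℕ) (a b : ℝ) : IsCompact (coefSet K a b) := by
  refine isCompact_of_isClosed_of_coord_bound (R := max |a| |b|) ?_ fun x hx i =>
    abs_le_max_abs_abs (hx i).1 (hx i).2
  have : coefSet K a b = ⋂ i, {x : Vec K | a ≤ x i} ∩ {x : Vec K | x i ≤ b} := by
    ext; simp [coefSet]
  rw [this]
  exact isClosed_iInter fun i => (isClosed_le continuous_const (by fun_prop)).inter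
    (isClosed_le (by fun_prop) continuous_const)

lemma coefSet_subset_posOrthant (n : ℕ) {a b : ℝ} (ha : 0 < a) : coefSet n a b ⊆ posOrthant n :=
  fun _ hx i => ha.trans_le (hx i).1

lemma isCompact_dictSet (F K : ℕ) (ε : ℝ) : IsCompact (dictSet F K ε) := by
  refine isCompact_of_isClosed_of_coord_bound (R := 1) ?_ fun x hx i => hx.2.2 i.2 i.1
  have : dictSet F K ε = ((⋂ i, ⋂ j, {W : Mat F K | 0 ≤ W (i, j)}) ∩
      ⋂ i, {W : Mat F K | ε ≤ ∑ j, |W (i, j)|}) ∩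
      ⋂ j, ⋂ i, {W : Mat F K | |W (i, j)| ≤ 1} := by
    ext; simp [dictSet, and_assoc]
  rw [this]
  refine (IsClosed.inter ?_ ?_).inter ?_
  · exact isClosed_iInter fun i => isClosed_iInter fun j => isClosed_le (by fun_prop) (by fun_prop)
  · exact isClosed_iInter fun i => isClosed_le (by fun_prop) (by fun_prop)
  · exact isClosed_iInter fun i => isClosed_iInter fun j => isClosed_le (by fun_prop) (by fun_prop)

lemma mem_dictSet_iff {ε : ℝ} {W : Mat F K} : W ∈ dictSet F K ε ↔
    (∀ i j, 0 ≤ W (i, j)) ∧ (∀ i, ε ≤ ∑ j, W (i, j)) ∧ ∀ j i, W (i, j) ≤ 1 := by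
  unfold dictSet
  refine and_congr_right fun h => ?_
  simp [abs_of_nonneg (h _ _)]

lemma convex_dictSet (F K : ℕ) (ε : ℝ) : Convex ℝ (dictSet F K ε) := by
  intro x hx y hy s t hs ht hst
  rw [mem_dictSet_iff] at *
  simp only [PiLp.add_apply, PiLp.smul_apply, smul_eq_mul]
  refine ⟨fun i j => add_nonneg (mul_nonneg hs (hx.1 i j)) (mul_nonneg ht (hy.1 i j)),
    fun i => ?_, fun j i => ?_⟩
  · rw [Finset.sum_add_distrib, ← Finset.mul_sum, ← Finset.mul_sum]
    calc ε = s * ε + t * ε := by rw [← add_mul, hst, one_mul]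
      _ ≤ _ := add_le_add (mul_le_mul_of_nonneg_left (hx.2.1 i) hs)
        (mul_le_mul_of_nonneg_left (hy.2.1 i) ht)
  · have h1 := mul_le_mul_of_nonneg_left (hx.2.2 j i) hs
    have h2 := mul_le_mul_of_nonneg_left (hy.2.2 j i) ht
    linarith

lemma mulVec_mem_coefSet {ε ε' U : ℝ} (hε' : 0 < ε') {W : Mat F K}
    (hW : W ∈ dictSet F K ε) {h : Vec K} (hh : h ∈ coefSet K ε' U) :
    mulVec W h ∈ coefSet F (ε * ε') (K * U) := by
  rw [mem_dictSet_iff] at hW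
  intro i
  rw [mulVec_apply]
  constructor
  · calc ε * ε' ≤ (∑ j, W (i, j)) * ε' := mul_le_mul_of_nonneg_right (hW.2.1 i) hε'.le
      _ = ∑ j, W (i, j) * ε' := Finset.sum_mul _ _ _
      _ ≤ _ := Finset.sum_le_sum fun j _ => mul_le_mul_of_nonneg_left (hh j).1 (hW.1 i j)
  · calc ∑ j, W (i, j) * h j ≤ ∑ _j : Fin K, 1 * U := Finset.sum_le_sum fun j _ =>
          mul_le_mul (hW.2.2 j i) (hh j).2 (hε'.le.trans (hh j).1) zero_le_one
      _ = K * U := by simp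

lemma closedBall_subset_coefSet {n : ℕ} {a b r : ℝ} {x : Vec n} (hx : x ∈ coefSet n a b) :
    Metric.closedBall x r ⊆ coefSet n (a - r) (b + r) := by
  intro y hy i
  rw [mem_closedBall_iff_norm] at hy
  have h1 := abs_le.1 ((PiLp.norm_apply_le (y - x) i).trans hy)
  simp only [PiLp.sub_apply] at h1
  have := hx i
  constructor <;> linarith

lemma exists_coefSet_of_isCompact {n : ℕ} {S : Set (Vec n)} (hS : IsCompact S)
    (hpos : S ⊆ posOrthant n) : ∃ a b, 0 < a ∧ S ⊆ coefSet n a b := by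
  have hi : ∀ i : Fin n, ∃ a b : ℝ, 0 < a ∧ ∀ x ∈ S, a ≤ x i ∧ x i ≤ b := by
    intro i
    rcases S.eq_empty_or_nonempty with rfl | hne
    · exact ⟨1, 0, one_pos, by simp⟩
    obtain ⟨x, hx, hmin⟩ := hS.exists_isMinOn (f := fun x : Vec n => x i) hne (by fun_prop)
    obtain ⟨y, hy, hmax⟩ := hS.exists_isMaxOn (f := fun x : Vec n => x i) hne (by fun_prop)
    exact ⟨x i, y i, hpos hx i, fun z hz => ⟨hmin hz, hmax hz⟩⟩
  choose a b ha hab using hi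
  rcases isEmpty_or_nonempty (Fin n) with hn | hn
  · exact ⟨1, 0, one_pos, fun x _ i => hn.elim i⟩
  obtain ⟨i₀, hi₀⟩ := Finite.exists_min a
  obtain ⟨j₀, hj₀⟩ := Finite.exists_max b
  exact ⟨a i₀, b j₀, ha i₀, fun x hx i =>
    ⟨(hi₀ i).trans (hab i x hx).1, (hab i x hx).2.trans (hj₀ i)⟩⟩

end MulVec

/-! ### The per-sample loss as a function of the dictionary -/

section Loss

variable {F K : ℕ}

/-- Quantitative control of `d(v‖·)` around the products `W h`. -/
structure LossBounds (d : Divergence F) (V : Set (Vec F)) (C : Set (Mat F K)) (H : Set (Vec K))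
    (M r R : ℝ) : Prop where
  M_nonneg : 0 ≤ M
  r_pos : 0 < r
  R_nonneg : 0 ≤ R
  convexOn : ∀ v ∈ V, ConvexOn ℝ (posOrthant F) (d v)
  ball_subset : ∀ W ∈ C, ∀ h ∈ H, Metric.closedBall (mulVec W h) r ⊆ posOrthant F
  bound : ∀ v ∈ V, ∀ W ∈ C, ∀ h ∈ H, ∀ y ∈ Metric.closedBall (mulVec W h) r, |d v y| ≤ M
  norm_le : ∀ h ∈ H, ‖h‖ ≤ R

/-- The per-sample loss has `ρ`-weak subgradients, given by the partial directional derivatives of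
the objective at minimizing coefficients. -/
def HasWeakLowerBound (d : Divergence F) (lam : ℝ) (V : Set (Vec F)) (C : Set (Mat F K))
    (H : Set (Vec K)) (ρ : ℝ) : Prop :=
  ∀ v ∈ V, ∀ W ∈ C, ∀ Z ∈ C, ∀ h ∈ H, IsMinOn (sampleObj d lam v W) H h →
    ∀ D, HasDirDeriv (d v) (mulVec W h) (mulVec (Z - W) h) D →
      D - ρ / 2 * ‖Z - W‖ ^ 2 ≤ sampleLoss d lam H v Z - sampleLoss d lam H v W

/-- `γ v` is the gradient of `d(v‖·)` at the products `W h`, Lipschitz along `h`. -/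
def HasLipschitzGradient (d : Divergence F) (V : Set (Vec F)) (C : Set (Mat F K))
    (H : Set (Vec K)) (γ : Vec F → Vec F → Vec F) (L : ℝ) : Prop :=
  ∀ v ∈ V, ∀ W ∈ C, ∀ h ∈ H,
    (∀ u, HasDirDeriv (d v) (mulVec W h) u (inner ℝ (γ v (mulVec W h)) u)) ∧
    ∀ k ∈ H, ‖γ v (mulVec W k) - γ v (mulVec W h)‖ ≤ L * ‖mulVec W k - mulVec W h‖

variable {d : Divergence F} {lam : ℝ} {V : Set (Vec F)} {C : Set (Mat F K)} {H : Set (Vec K)}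
  {M r R : ℝ}

lemma hasDirDeriv_mulVec_iff {φ : Vec F → ℝ} {W U : Mat F K} {h : Vec K} {D : ℝ} :
    HasDirDeriv (fun W' => φ (mulVec W' h)) W U D ↔
      HasDirDeriv φ (mulVec W h) (mulVec U h) D := by
  simp [HasDirDeriv, mulVec_add_smul]

lemma sampleLoss_eq_of_isMinOn {v : Vec F} {W : Mat F K} {h : Vec K} (hh : h ∈ H)
    (hmin : IsMinOn (sampleObj d lam v W) H h) :
    sampleLoss d lam H v W = sampleObj d lam v W h :=
  IsLeast.csInf_eq ⟨Set.mem_image_of_mem _ hh, by rintro _ ⟨k, hk, rfl⟩; exact hmin hk⟩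

lemma LossBounds.mem_posOrthant (hb : LossBounds d V C H M r R) {W : Mat F K} (hW : W ∈ C)
    {h : Vec K} (hh : h ∈ H) : mulVec W h ∈ posOrthant F :=
  hb.ball_subset W hW h hh (Metric.mem_closedBall_self hb.r_pos.le)

lemma LossBounds.exists_hasDirDeriv (hb : LossBounds d V C H M r R) {v : Vec F} (hv : v ∈ V)
    {W : Mat F K} (hW : W ∈ C) {h : Vec K} (hh : h ∈ H) (u : Vec F) :
    ∃ D, HasDirDeriv (d v) (mulVec W h) u D :=
  exists_hasDirDeriv_of_convexOn (hb.convexOn v hv) (isOpen_posOrthant F)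
    (hb.mem_posOrthant hW hh) u

/-- The minimizer `k` for `Z` competes at `W`; the regularizer cancels and the local Lipschitz bound
for convex functions remains. -/
lemma LossBounds.sampleLoss_sub_le (hb : LossBounds d V C H M r R)
    (hmin : ∀ v ∈ V, ∀ W ∈ C, ∃ h ∈ H, IsMinOn (sampleObj d lam v W) H h) {v : Vec F} (hv : v ∈ V)
    {W Z : Mat F K} (hW : W ∈ C) (hZ : Z ∈ C) :
    sampleLoss d lam H v W - sampleLoss d lam H v Z ≤ 2 * M / r * R * ‖W - Z‖ := by
  obtain ⟨h, hh, hhm⟩ := hmin v hv W hW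
  obtain ⟨k, hk, hkm⟩ := hmin v hv Z hZ
  rw [sampleLoss_eq_of_isMinOn hh hhm, sampleLoss_eq_of_isMinOn hk hkm]
  have h1 : sampleObj d lam v W h ≤ sampleObj d lam v W k := hhm hk
  have h2 := sub_le_of_convexOn_of_bound (hb.convexOn v hv) hb.r_pos (hb.ball_subset W hW k hk)
    (hb.bound v hv W hW k hk) (hb.mem_posOrthant hZ hk)
    (hb.bound v hv Z hZ k hk _ (Metric.mem_closedBall_self hb.r_pos.le))
  rw [← mulVec_sub_left] at h2
  have h3 : ‖mulVec (W - Z) k‖ ≤ ‖W - Z‖ * R := (norm_mulVec_le _ _).trans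
    (mul_le_mul_of_nonneg_left (hb.norm_le k hk) (norm_nonneg _))
  have h4 := mul_le_mul_of_nonneg_left h3
    (div_nonneg (mul_nonneg zero_le_two hb.M_nonneg) hb.r_pos.le)
  simp only [sampleObj] at *
  linarith

lemma LossBounds.abs_sampleLoss_sub_le (hb : LossBounds d V C H M r R)
    (hmin : ∀ v ∈ V, ∀ W ∈ C, ∃ h ∈ H, IsMinOn (sampleObj d lam v W) H h) {v : Vec F} (hv : v ∈ V)
    {W Z : Mat F K} (hW : W ∈ C) (hZ : Z ∈ C) :
    |sampleLoss d lam H v W - sampleLoss d lam H v Z| ≤ 2 * M / r * R * ‖W - Z‖ := by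
  rw [abs_sub_le_iff]
  exact ⟨hb.sampleLoss_sub_le hmin hv hW hZ,
    norm_sub_rev W Z ▸ hb.sampleLoss_sub_le hmin hv hZ hW⟩

lemma add_smul_sub_mem_of_convex {E : Type*} [AddCommGroup E] [Module ℝ E] {S : Set E}
    (hS : Convex ℝ S) {x y : E} (hx : x ∈ S) (hy : y ∈ S) {δ : ℝ} (hδ : δ ∈ Set.Ioo (0 : ℝ) 1) :
    x + δ • (y - x) ∈ S :=
  hS.add_smul_sub_mem hx hy ⟨hδ.1.le, hδ.2.le⟩

/-- An envelope argument: freezing the minimizer `h` bounds the difference quotients above, the weak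
lower bound bounds them below, and both bounds tend to `D`. -/
lemma LossBounds.exists_hasDirDeriv_sampleLoss (hb : LossBounds d V C H M r R)
    (hC : Convex ℝ C) {ρ : ℝ} (hρ : HasWeakLowerBound d lam V C H ρ)
    (hmin : ∀ v ∈ V, ∀ W ∈ C, ∃ h ∈ H, IsMinOn (sampleObj d lam v W) H h) {v : Vec F} (hv : v ∈ V)
    {W Z : Mat F K} (hW : W ∈ C) (hZ : Z ∈ C) :
    ∃ D, HasDirDeriv (sampleLoss d lam H v) W (Z - W) D := by
  obtain ⟨h, hh, hhm⟩ := hmin v hv W hW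
  obtain ⟨D, hD⟩ := hb.exists_hasDirDeriv hv hW hh (mulVec (Z - W) h)
  refine ⟨D, ?_⟩
  have hlow : Tendsto (fun δ : ℝ => D - ρ / 2 * δ * ‖Z - W‖ ^ 2) (𝓝[>] 0) (𝓝 D) :=
    (Continuous.tendsto' (by fun_prop) 0 _ (by ring)).mono_left nhdsWithin_le_nhds
  refine tendsto_of_tendsto_of_tendsto_of_le_of_le' hlow (hasDirDeriv_mulVec_iff.2 hD) ?_ ?_
  · filter_upwards [Ioo_mem_nhdsGT (zero_lt_one' ℝ)] with δ hδ
    have hWδ := add_smul_sub_mem_of_convex hC hW hZ hδ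
    have h1 := hD.smul hδ.1
    have h2 : δ • mulVec (Z - W) h = mulVec (W + δ • (Z - W) - W) h := by
      rw [mulVec_sub_left (W + _), mulVec_add_smul]; abel
    rw [h2] at h1
    have h3 := hρ v hv W hW _ hWδ h hh hhm _ h1
    rw [add_sub_cancel_left, norm_smul, Real.norm_of_nonneg hδ.1.le] at h3
    rw [le_div_iff₀ hδ.1]
    linarith [show (D - ρ / 2 * δ * ‖Z - W‖ ^ 2) * δ = δ * D - ρ / 2 * (δ * ‖Z - W‖) ^ 2 by ring]
  · filter_upwards [Ioo_mem_nhdsGT (zero_lt_one' ℝ)] with δ hδ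
    have hWδ := add_smul_sub_mem_of_convex hC hW hZ hδ
    refine div_le_div_of_nonneg_right ?_ hδ.1.le
    obtain ⟨k, hk, hkm⟩ := hmin v hv _ hWδ
    rw [sampleLoss_eq_of_isMinOn hh hhm, sampleLoss_eq_of_isMinOn hk hkm]
    have h1 : sampleObj d lam v (W + δ • (Z - W)) k ≤ sampleObj d lam v (W + δ • (Z - W)) h :=
      hkm hh
    simp only [sampleObj] at *
    linarith

/-- Dominated convergence: the Lipschitz constant of the sample loss is uniform in `v ∈ V` and
dominates the quotients. -/
lemma LossBounds.exists_hasDirDeriv_expLoss (hb : LossBounds d V C H M r R)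
    (hC : Convex ℝ C) {ρ : ℝ} (hρ : HasWeakLowerBound d lam V C H ρ)
    (hmin : ∀ v ∈ V, ∀ W ∈ C, ∃ h ∈ H, IsMinOn (sampleObj d lam v W) H h)
    {P : Measure (Vec F)} [IsProbabilityMeasure P] (hP : ∀ᵐ v ∂P, v ∈ V)
    (hint : ∀ W ∈ C, Integrable (fun v => sampleLoss d lam H v W) P)
    {W Z : Mat F K} (hW : W ∈ C) (hZ : Z ∈ C) :
    ∃ D, HasDirDeriv (expLoss d lam H P) W (Z - W) D := by
  have hex : ∀ v, ∃ D, v ∈ V → HasDirDeriv (sampleLoss d lam H v) W (Z - W) D := fun v => by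
    by_cases hv : v ∈ V
    · obtain ⟨D, hD⟩ := hb.exists_hasDirDeriv_sampleLoss hC hρ hmin hv hW hZ
      exact ⟨D, fun _ => hD⟩
    · exact ⟨0, fun h => absurd h hv⟩
  choose D hD using hex
  refine ⟨∫ v, D v ∂P, ?_⟩
  have key : Tendsto (fun δ : ℝ => ∫ v, (sampleLoss d lam H v (W + δ • (Z - W))
      - sampleLoss d lam H v W) / δ ∂P) (𝓝[>] 0) (𝓝 (∫ v, D v ∂P)) := by
    refine tendsto_integral_filter_of_dominated_convergence
      (fun _ => 2 * M / r * R * ‖Z - W‖) ?_ ?_ (integrable_const _) ?_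
    · filter_upwards [Ioo_mem_nhdsGT (zero_lt_one' ℝ)] with δ hδ
      exact (((hint _ (add_smul_sub_mem_of_convex hC hW hZ hδ)).sub
        (hint W hW)).div_const δ).aestronglyMeasurable
    · filter_upwards [Ioo_mem_nhdsGT (zero_lt_one' ℝ)] with δ hδ
      filter_upwards [hP] with v hv
      have h1 := hb.abs_sampleLoss_sub_le hmin hv (add_smul_sub_mem_of_convex hC hW hZ hδ) hW
      rw [add_sub_cancel_left, norm_smul, Real.norm_of_nonneg hδ.1.le] at h1
      rw [Real.norm_eq_abs, abs_div, abs_of_pos hδ.1, div_le_iff₀ hδ.1]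
      linarith
    · filter_upwards [hP] with v hv using hD v hv
  refine Tendsto.congr' ?_ key
  filter_upwards [Ioo_mem_nhdsGT (zero_lt_one' ℝ)] with δ hδ
  rw [integral_div, integral_sub (hint _ (add_smul_sub_mem_of_convex hC hW hZ hδ)) (hint W hW)]
  rfl

lemma LossBounds.inner_le_of_subgradient (hb : LossBounds d V C H M r R)
    {ρ : ℝ} (hρ : HasWeakLowerBound d lam V C H ρ) {v : Vec F} (hv : v ∈ V)
    {W Z G : Mat F K} (hW : W ∈ C) (hZ : Z ∈ C) {h : Vec K} (hh : h ∈ H)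
    (hhm : IsMinOn (sampleObj d lam v W) H h)
    (hG : G ∈ frechetSubdifferential (fun W' => d v (mulVec W' h)) W) :
    inner ℝ G (Z - W) ≤
      sampleLoss d lam H v Z - sampleLoss d lam H v W + ρ / 2 * ‖Z - W‖ ^ 2 := by
  obtain ⟨D, hD⟩ := hb.exists_hasDirDeriv hv hW hh (mulVec (Z - W) h)
  have h1 := inner_le_of_mem_frechetSubdifferential hG (hasDirDeriv_mulVec_iff.2 hD)
  have h2 := hρ v hv W hW Z hZ h hh hhm D hD
  linarith

/-- Test the subgradient inequality in the direction `G` itself. -/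
lemma LossBounds.norm_subgradient_le (hb : LossBounds d V C H M r R) {v : Vec F} (hv : v ∈ V)
    {W G : Mat F K} (hW : W ∈ C) {h : Vec K} (hh : h ∈ H)
    (hG : G ∈ frechetSubdifferential (fun W' => d v (mulVec W' h)) W) :
    ‖G‖ ≤ 2 * M / r * R := by
  have hc : 0 ≤ 2 * M / r := div_nonneg (mul_nonneg zero_le_two hb.M_nonneg) hb.r_pos.le
  obtain ⟨D, hD⟩ := hb.exists_hasDirDeriv hv hW hh (mulVec G h)
  have h1 := inner_le_of_mem_frechetSubdifferential hG (hasDirDeriv_mulVec_iff.2 hD)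
  have h2 := hD.le_of_convexOn_of_bound (hb.convexOn v hv) hb.r_pos (hb.ball_subset W hW h hh)
    (hb.bound v hv W hW h hh)
  have h3 : ‖mulVec G h‖ ≤ ‖G‖ * R := (norm_mulVec_le _ _).trans
    (mul_le_mul_of_nonneg_left (hb.norm_le h hh) (norm_nonneg _))
  rw [real_inner_self_eq_norm_sq] at h1
  rcases (norm_nonneg G).eq_or_lt with h0 | h0
  · rw [← h0]; exact mul_nonneg hc hb.R_nonneg
  · refine le_of_mul_le_mul_left ?_ h0
    nlinarith [mul_le_mul_of_nonneg_left h3 hc]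

/-- With a single coefficient vector the sample loss is convex in the dictionary, so no smoothness
is required. -/
lemma LossBounds.hasWeakLowerBound_of_subsingleton (hb : LossBounds d V C H M r R)
    (hH : H.Subsingleton) {ρ : ℝ} (hρ : 0 ≤ ρ) : HasWeakLowerBound d lam V C H ρ := by
  intro v hv W hW Z hZ h hh hhm D hD
  have hmin : ∀ W, IsMinOn (sampleObj d lam v W) H h := fun W k hk =>
    (congrArg (sampleObj d lam v W) (hH hh hk)).le
  rw [sampleLoss_eq_of_isMinOn hh (hmin W), sampleLoss_eq_of_isMinOn hh (hmin Z)]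
  rw [mulVec_sub_left] at hD
  have h1 := hD.le_sub_of_convexOn (hb.convexOn v hv) (hb.mem_posOrthant hW hh)
    (hb.mem_posOrthant hZ hh)
  have : 0 ≤ ρ / 2 * ‖Z - W‖ ^ 2 := by positivity
  simp only [sampleObj]
  linarith

lemma LossBounds.hasWeakLowerBound_of_lipschitz (hb : LossBounds d V C H M r R)
    {m : ℝ} (hm : 0 < m)
    (hsc : ∀ v ∈ V, ∀ W ∈ C, StrongConvexOn H m (sampleObj d lam v W))
    (hmin : ∀ v ∈ V, ∀ W ∈ C, ∃ h ∈ H, IsMinOn (sampleObj d lam v W) H h)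
    {γ : Vec F → Vec F → Vec F} {L B : ℝ} (hL : 0 ≤ L) (hB : 0 ≤ B) (hCB : ∀ W ∈ C, ‖W‖ ≤ B)
    (hγ : HasLipschitzGradient d V C H γ L) :
    HasWeakLowerBound d lam V C H ((L * B * R + 2 * M / r) ^ 2 / m) := by
  intro v hv W hW Z hZ h hh hhm D hD
  obtain ⟨k, hk, hkm⟩ := hmin v hv Z hZ
  rw [sampleLoss_eq_of_isMinOn hh hhm, sampleLoss_eq_of_isMinOn hk hkm]
  obtain ⟨hgh, hlip⟩ := hγ v hv W hW h hh
  obtain ⟨hgk, -⟩ := hγ v hv W hW k hk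
  have hDeq := hD.unique (hgh _)
  have hc : 0 ≤ 2 * M / r := div_nonneg (mul_nonneg zero_le_two hb.M_nonneg) hb.r_pos.le
  have hgrowth := quadratic_growth_of_strongConvexOn (hsc v hv W hW) hh hhm hk
  have h1 := (hgk (mulVec Z k - mulVec W k)).le_sub_of_convexOn (hb.convexOn v hv)
    (hb.mem_posOrthant hW hk) (hb.mem_posOrthant hZ hk)
  rw [← mulVec_sub_left] at h1
  set a := γ v (mulVec W k)
  set b := γ v (mulVec W h)
  have hbn : ‖b‖ ≤ 2 * M / r := by
    have h2 := (hgh b).le_of_convexOn_of_bound (hb.convexOn v hv) hb.r_pos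
      (hb.ball_subset W hW h hh) (hb.bound v hv W hW h hh)
    rw [real_inner_self_eq_norm_sq] at h2
    rcases (norm_nonneg b).eq_or_lt with h0 | h0
    · rw [← h0]; exact hc
    · exact le_of_mul_le_mul_right (by linarith [sq ‖b‖]) h0
  -- Both terms on the right are of order `‖k - h‖ * ‖Z - W‖`: the first by the Lipschitz gradient,
  -- the second by the bound on `b`.
  have hsplit : inner ℝ a (mulVec (Z - W) k) - inner ℝ b (mulVec (Z - W) h)
      = inner ℝ (a - b) (mulVec (Z - W) k) + inner ℝ b (mulVec (Z - W) (k - h)) := by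
    rw [mulVec_sub_right, inner_sub_left, inner_sub_right]; ring
  have h2 : ‖a - b‖ ≤ L * B * ‖k - h‖ := by
    refine (hlip k hk).trans ?_
    rw [← mulVec_sub_right, mul_assoc]
    refine mul_le_mul_of_nonneg_left ((norm_mulVec_le _ _).trans ?_) hL
    exact mul_le_mul_of_nonneg_right (hCB W hW) (norm_nonneg _)
  have h3 : ‖mulVec (Z - W) k‖ ≤ ‖Z - W‖ * R := (norm_mulVec_le _ _).trans
    (mul_le_mul_of_nonneg_left (hb.norm_le k hk) (norm_nonneg _))
  have h4 : -(L * B * ‖k - h‖ * (‖Z - W‖ * R)) ≤ inner ℝ (a - b) (mulVec (Z - W) k) := by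
    have := (abs_le.1 (abs_real_inner_le_norm (a - b) (mulVec (Z - W) k))).1
    have := mul_le_mul h2 h3 (norm_nonneg _) (by positivity)
    linarith
  have h5 : -(2 * M / r * (‖Z - W‖ * ‖k - h‖)) ≤ inner ℝ b (mulVec (Z - W) (k - h)) := by
    have := (abs_le.1 (abs_real_inner_le_norm b (mulVec (Z - W) (k - h)))).1
    have := mul_le_mul hbn (norm_mulVec_le (Z - W) (k - h)) (norm_nonneg _) hc
    linarith
  set Q := L * B * R + 2 * M / r
  -- Completing the square against the quadratic growth fixes `ρ = Q ^ 2 / m`.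
  have h6 : 0 ≤ m / 2 * ‖k - h‖ ^ 2 - Q * ‖k - h‖ * ‖Z - W‖ + Q ^ 2 / m / 2 * ‖Z - W‖ ^ 2 := by
    have : m / 2 * ‖k - h‖ ^ 2 - Q * ‖k - h‖ * ‖Z - W‖ + Q ^ 2 / m / 2 * ‖Z - W‖ ^ 2
        = (m * ‖k - h‖ - Q * ‖Z - W‖) ^ 2 / (2 * m) := by field_simp; ring
    rw [this]; positivity
  have h7 : Q * ‖k - h‖ * ‖Z - W‖
      = L * B * ‖k - h‖ * (‖Z - W‖ * R) + 2 * M / r * (‖Z - W‖ * ‖k - h‖) := by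
    simp only [Q]; ring
  simp only [sampleObj] at *
  linarith

/-! ### Estimates for one projected step. -/

lemma norm_sub_projection_le {E : Type*} [NormedAddCommGroup E] [InnerProductSpace ℝ E]
    {C : Set E} {w g p : E} {η : ℝ} (hη : 0 ≤ η) (hw : w ∈ C) (hp : IsProjection C (w - η • g) p) :
    ‖p - w‖ ≤ 2 * (η * ‖g‖) := by
  have h1 := hp.2 w hw
  have h2 : ‖(w - η • g) - w‖ = η * ‖g‖ := by
    rw [sub_sub_cancel_left, norm_neg, norm_smul, Real.norm_of_nonneg hη]
  have h3 : p - w = -((w - η • g) - p) + ((w - η • g) - w) := by abel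
  rw [h3]
  refine (norm_add_le _ _).trans ?_
  rw [norm_neg]
  linarith

lemma norm_sub_projection_sq_le {E : Type*} [NormedAddCommGroup E] [InnerProductSpace ℝ E]
    {C : Set E} (hC : Convex ℝ C) {x p z : E} (hz : z ∈ C) (hp : IsProjection C x p) :
    ‖z - p‖ ^ 2 ≤ ‖z - x‖ ^ 2 := by
  have hinf : ‖x - p‖ = ⨅ w : C, ‖x - w‖ := by
    have : Nonempty C := ⟨⟨p, hp.1⟩⟩
    refine le_antisymm (le_ciInf fun w => hp.2 w w.2)
      (ciInf_le (f := fun w : C => ‖x - w‖) ⟨0, ?_⟩ ⟨p, hp.1⟩)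
    rintro _ ⟨w, rfl⟩
    exact norm_nonneg _
  have h1 := (norm_eq_iInf_iff_real_inner_le_zero hC hp.1).1 hinf z hz
  have h2 : ‖z - x‖ ^ 2 = ‖z - p‖ ^ 2 - 2 * inner ℝ (x - p) (z - p) + ‖x - p‖ ^ 2 := by
    rw [show z - x = (z - p) - (x - p) by abel, norm_sub_sq_real, real_inner_comm]
  nlinarith [sq_nonneg ‖x - p‖]

lemma projection_step_sq_le {E : Type*} [NormedAddCommGroup E] [InnerProductSpace ℝ E]
    {C : Set E} (hC : Convex ℝ C) {w g p z : E} {η : ℝ} (hz : z ∈ C)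
    (hp : IsProjection C (w - η • g) p) :
    ‖z - p‖ ^ 2 ≤ ‖z - w‖ ^ 2 + 2 * η * inner ℝ g (z - w) + η ^ 2 * ‖g‖ ^ 2 := by
  refine (norm_sub_projection_sq_le hC hz hp).trans (le_of_eq ?_)
  rw [show z - (w - η • g) = (z - w) + η • g by abel, norm_add_sq_real, inner_smul_right,
    real_inner_comm, norm_smul, mul_pow, Real.norm_eq_abs, sq_abs]
  ring

end Loss

/-! ### Regularity of the listed divergences -/

section Listed

variable {n : ℕ}

/-- On the box `[a, b]ⁿ` the function `d(x‖·)` has a gradient that is Lipschitz, uniformly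
in `x`. -/
def HasLipschitzGradientOnBox (d : Divergence n) (a b : ℝ) : Prop :=
  ∃ (γ : Vec n → Vec n → Vec n) (L : ℝ), 0 ≤ L ∧ ∀ x ∈ coefSet n a b, ∀ y ∈ coefSet n a b,
    (∀ u, HasDirDeriv (d x) y u (inner ℝ (γ x y) u)) ∧
    ∀ z ∈ coefSet n a b, ‖γ x z - γ x y‖ ≤ L * ‖z - y‖

lemma hasDirDeriv_of_hasDerivAt {E : Type*} [NormedAddCommGroup E] [InnerProductSpace ℝ E]
    {f : E → ℝ} {x u : E} {D : ℝ} (h : HasDerivAt (fun t : ℝ => f (x + t • u)) D 0) :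
    HasDirDeriv f x u D := by
  have := (hasDerivAt_iff_tendsto_slope.1 h).mono_left
    (nhdsWithin_mono 0 fun t (ht : t ∈ Set.Ioi (0 : ℝ)) => ht.ne')
  refine this.congr fun t => ?_
  simp [slope_def_field]

lemma hasLipschitzGradientOnBox_sum {ψ ψ' : ℝ → ℝ → ℝ} {a b L : ℝ} (hL : 0 ≤ L)
    (hψ : ∀ x ∈ Set.Icc a b, ∀ y ∈ Set.Icc a b, HasDerivAt (ψ x) (ψ' x y) y)
    (hlip : ∀ x ∈ Set.Icc a b, ∀ y ∈ Set.Icc a b, ∀ z ∈ Set.Icc a b,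
      |ψ' x z - ψ' x y| ≤ L * |z - y|) :
    HasLipschitzGradientOnBox (n := n) (fun x y => ∑ i, ψ (x i) (y i)) a b := by
  refine ⟨fun x y => WithLp.toLp 2 fun i => ψ' (x i) (y i), L, hL, fun x hx y hy => ⟨fun u => ?_,
    fun z hz => ?_⟩⟩
  · apply hasDirDeriv_of_hasDerivAt
    have h1 : ∀ i, HasDerivAt (fun t : ℝ => ψ (x i) ((y + t • u) i))
        (ψ' (x i) (y i) * u i) 0 := by
      intro i
      have h2 : HasDerivAt (fun t : ℝ => (y + t • u) i) (u i) 0 := by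
        simpa using ((hasDerivAt_id (0 : ℝ)).mul_const (u i)).const_add (y i)
      have h3 : HasDerivAt (ψ (x i)) (ψ' (x i) (y i)) ((y + (0 : ℝ) • u) i) := by
        simpa using hψ (x i) (hx i) (y i) (hy i)
      exact h3.comp 0 h2
    have h4 := HasDerivAt.fun_sum (u := Finset.univ) fun i _ => h1 i
    refine h4.congr_deriv ?_
    rw [PiLp.inner_apply]
    exact Finset.sum_congr rfl fun i _ => mul_comm _ _
  · refine le_of_sq_le_sq ?_ (by positivity)
    rw [mul_pow, EuclideanSpace.real_norm_sq_eq, EuclideanSpace.real_norm_sq_eq, Finset.mul_sum]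
    refine Finset.sum_le_sum fun i _ => ?_
    have h := pow_le_pow_left₀ (abs_nonneg _) (hlip (x i) (hx i) (y i) (hy i) (z i) (hz i)) 2
    rw [mul_pow, sq_abs, sq_abs] at h
    simpa using h

lemma exists_lipschitz_rpow {a b : ℝ} (ha : 0 < a) (p : ℝ) :
    ∃ L, 0 ≤ L ∧ ∀ y ∈ Set.Icc a b, ∀ z ∈ Set.Icc a b, |z ^ p - y ^ p| ≤ L * |z - y| := by
  have hcont : ContinuousOn (fun y : ℝ => p * y ^ (p - 1)) (Set.Icc a b) :=
    continuousOn_const.mul (continuousOn_id.rpow_const fun y hy => Or.inl (ha.trans_le hy.1).ne')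
  obtain ⟨L, hL⟩ := isCompact_Icc.exists_bound_of_continuousOn hcont
  refine ⟨max L 0, le_max_right _ _, fun y hy z hz => ?_⟩
  exact (convex_Icc a b).norm_image_sub_le_of_norm_hasDerivWithin_le
    (fun y hy => (Real.hasDerivAt_rpow_const (Or.inl (ha.trans_le hy.1).ne')).hasDerivWithinAt)
    (fun y hy => (hL y hy).trans (le_max_left _ _)) hy hz

/-- Divergences with a coordinate derivative of the form `c + A(x) y^p + B(x) y^q`. -/
lemma hasLipschitzGradientOnBox_of_rpow {ψ : ℝ → ℝ → ℝ} {a b : ℝ} (ha : 0 < a) {A B : ℝ → ℝ}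
    (hA : ContinuousOn A (Set.Ioi 0)) (hB : ContinuousOn B (Set.Ioi 0)) (c p q : ℝ)
    (hψ : ∀ x, 0 < x → ∀ y, 0 < y → HasDerivAt (ψ x) (c + A x * y ^ p + B x * y ^ q) y) :
    HasLipschitzGradientOnBox (n := n) (fun x y => ∑ i, ψ (x i) (y i)) a b := by
  have hsub : Set.Icc a b ⊆ Set.Ioi 0 := fun x hx => ha.trans_le hx.1
  obtain ⟨MA, hMA⟩ := isCompact_Icc.exists_bound_of_continuousOn (hA.mono hsub)
  obtain ⟨MB, hMB⟩ := isCompact_Icc.exists_bound_of_continuousOn (hB.mono hsub)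
  obtain ⟨Lp, hLp0, hLp⟩ := exists_lipschitz_rpow (b := b) ha p
  obtain ⟨Lq, hLq0, hLq⟩ := exists_lipschitz_rpow (b := b) ha q
  refine hasLipschitzGradientOnBox_sum (ψ' := fun x y => c + A x * y ^ p + B x * y ^ q)
    (L := |MA| * Lp + |MB| * Lq) (by positivity)
    (fun x hx y hy => hψ x (hsub hx) y (hsub hy)) fun x hx y hy z hz => ?_
  have h1 : c + A x * z ^ p + B x * z ^ q - (c + A x * y ^ p + B x * y ^ q)
      = A x * (z ^ p - y ^ p) + B x * (z ^ q - y ^ q) := by ring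
  rw [h1]
  refine (abs_add_le _ _).trans ?_
  rw [abs_mul, abs_mul]
  have h2 := mul_le_mul ((hMA x hx).trans (le_abs_self _)) (hLp y hy z hz) (abs_nonneg _)
    (abs_nonneg _)
  have h3 := mul_le_mul ((hMB x hx).trans (le_abs_self _)) (hLq y hy z hz) (abs_nonneg _)
    (abs_nonneg _)
  rw [Real.norm_eq_abs] at h2 h3
  linarith

lemma HasLipschitzGradientOnBox.congr {d d' : Divergence n} {a b : ℝ} (ha : 0 < a)
    (h : HasLipschitzGradientOnBox d a b)
    (hd : ∀ x ∈ posOrthant n, ∀ y ∈ posOrthant n, d x y = d' x y) :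
    HasLipschitzGradientOnBox d' a b := by
  obtain ⟨γ, L, hL, hγ⟩ := h
  refine ⟨γ, L, hL, fun x hx y hy => ⟨fun u => ?_, (hγ x hx y hy).2⟩⟩
  refine ((hγ x hx y hy).1 u).congr_of_eventuallyEq ?_
  filter_upwards [(isOpen_posOrthant n).mem_nhds (coefSet_subset_posOrthant n ha hy)] with z hz
  exact hd x (coefSet_subset_posOrthant n ha hx) z hz

/-- The three closed pieces overlap at `±a`, where their derivatives agree. Written as a truncation,
the derivative is visibly 1-Lipschitz. -/
lemma hasDerivAt_huber {a : ℝ} (ha : 0 < a) (u : ℝ) :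
    HasDerivAt (huber a) (max (-a) (min u a)) u := by
  have hmid : ∀ v, |v| ≤ a → HasDerivWithinAt (huber a) v {v | |v| ≤ a} v := by
    intro v hv
    have h : HasDerivAt (fun u : ℝ => u ^ 2 / 2) v v := by
      simpa using (hasDerivAt_pow 2 v).div_const 2
    exact h.hasDerivWithinAt.congr (fun w hw => if_pos hw) (if_pos hv)
  have hval : ∀ v, a ≤ v → huber a v = a * (v - a / 2) := by
    intro v hv
    unfold huber
    rw [abs_of_nonneg (ha.le.trans hv)]
    split_ifs with h
    · have : v = a := le_antisymm h hv
      subst this; ring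
    · rfl
  have hval' : ∀ v, v ≤ -a → huber a v = a * (-v - a / 2) := by
    intro v hv
    have h := hval (-v) (by linarith)
    rwa [show huber a (-v) = huber a v by simp [huber]] at h
  have hright : ∀ v, a ≤ v → HasDerivWithinAt (huber a) a {v | a ≤ v} v := by
    intro v hv
    have h : HasDerivAt (fun u : ℝ => a * (u - a / 2)) a v := by
      simpa using ((hasDerivAt_id v).sub_const (a / 2)).const_mul a
    exact h.hasDerivWithinAt.congr (fun w hw => hval w hw) (hval v hv)
  have hleft : ∀ v, v ≤ -a → HasDerivWithinAt (huber a) (-a) {v | v ≤ -a} v := by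
    intro v hv
    have h : HasDerivAt (fun u : ℝ => a * (-u - a / 2)) (-a) v := by
      simpa using (((hasDerivAt_id v).neg).sub_const (a / 2)).const_mul a
    exact h.hasDerivWithinAt.congr (fun w hw => hval' w hw) (hval' v hv)
  have hcover : ∀ {s t : Set ℝ} {D : ℝ}, s ∪ t ∈ 𝓝 u → HasDerivWithinAt (huber a) D s u →
      HasDerivWithinAt (huber a) D t u → HasDerivAt (huber a) D u :=
    fun hst h1 h2 => (h1.union h2).hasDerivAt hst
  rcases lt_trichotomy u (-a) with h | h | h
  · rw [min_eq_left (by linarith), max_eq_left h.le]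
    exact (hleft u h.le).hasDerivAt (Iic_mem_nhds h)
  · rw [min_eq_left (by linarith), max_eq_left h.le]
    have h0 := hmid u (by rw [h, abs_neg, abs_of_pos ha])
    nth_rewrite 1 [h] at h0
    refine hcover ?_ (hleft u h.le) h0
    filter_upwards [Iio_mem_nhds (show u < a by linarith)] with w hw
    rcases le_total w (-a) with h' | h'
    · exact Or.inl h'
    · exact Or.inr (abs_le.2 ⟨h', le_of_lt hw⟩)
  · rcases lt_trichotomy u a with h2 | h2 | h2
    · rw [min_eq_left h2.le, max_eq_right h.le]
      refine (hmid u (abs_le.2 ⟨h.le, h2.le⟩)).hasDerivAt ?_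
      filter_upwards [Ioo_mem_nhds h h2] with w hw using abs_le.2 ⟨hw.1.le, hw.2.le⟩
    · rw [min_eq_right h2.ge, max_eq_right (by linarith)]
      have h0 := hmid u (by rw [h2, abs_of_pos ha])
      nth_rewrite 1 [h2] at h0
      refine hcover ?_ (hright u h2.ge) h0
      filter_upwards [Ioi_mem_nhds h] with w hw
      rcases le_total a w with h' | h'
      · exact Or.inl h'
      · exact Or.inr (abs_le.2 ⟨le_of_lt hw, h'⟩)
    · rw [min_eq_right h2.le, max_eq_right (by linarith)]
      exact (hright u h2.le).hasDerivAt (Ici_mem_nhds h2)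

lemma hasLipschitzGradientOnBox_huberLoss {α : ℝ} (hα : 0 < α) (a b : ℝ) :
    HasLipschitzGradientOnBox (huberLoss n α) a b := by
  refine hasLipschitzGradientOnBox_sum (ψ := fun x y => huber α (x - y))
    (ψ' := fun x y => -max (-α) (min (x - y) α)) zero_le_one (fun x _ y _ => ?_)
    fun x _ y _ z _ => ?_
  · have := (hasDerivAt_huber hα (x - y)).comp y ((hasDerivAt_id y).const_sub x)
    exact this.congr_deriv (by ring)
  · have h1 : |max (-α) (min (x - y) α) - max (-α) (min (x - z) α)| ≤ |(x - y) - (x - z)| := by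
      rw [max_comm (-α), max_comm (-α)]
      exact (abs_max_sub_max_le_abs _ _ _).trans (abs_inf_sub_inf_le_abs _ _ _)
    rw [neg_sub_neg, one_mul]
    rwa [show x - y - (x - z) = z - y by ring] at h1

lemma hasLipschitzGradientOnBox_alpha {α : ℝ} {a b : ℝ} (ha : 0 < a) :
    HasLipschitzGradientOnBox (alphaDivergence n α) a b := by
  have h : HasLipschitzGradientOnBox (n := n) (fun x y => ∑ i,
      1 / (α * (α - 1)) * (x i ^ α * y i ^ (1 - α) - y i - α * (x i - y i))) a b := by
    refine hasLipschitzGradientOnBox_of_rpow (n := n) (ψ := fun x y => 1 / (α * (α - 1)) * (x ^ α * y ^ (1 - α) - y - α * (x - y))) ha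
      (A := fun x => 1 / (α * (α - 1)) * ((1 - α) * x ^ α)) (B := fun _ => 0) ?_
      continuousOn_const (1 / (α * (α - 1)) * (α - 1)) (-α) 0 fun x hx y hy => ?_
    · exact continuousOn_const.mul (continuousOn_const.mul
        (continuousOn_id.rpow_const fun y hy => Or.inl (ne_of_gt hy)))
    · have h1 : HasDerivAt (fun y : ℝ => y ^ (1 - α)) ((1 - α) * y ^ (1 - α - 1)) y :=
        Real.hasDerivAt_rpow_const (Or.inl hy.ne')
      have h2 := ((((h1.const_mul (x ^ α)).sub (hasDerivAt_id y)).sub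
        (((hasDerivAt_id y).const_sub x).const_mul α)).const_mul (1 / (α * (α - 1))))
      refine h2.congr_deriv ?_
      rw [show 1 - α - 1 = -α by ring]; ring
  refine h.congr ha fun x hx y hy => ?_
  simp only [alphaDivergence, Finset.mul_sum]
  refine Finset.sum_congr rfl fun i _ => ?_
  rw [Real.div_rpow (hx i).le (hy i).le, Real.rpow_sub (hy i), Real.rpow_one]
  ring

lemma hasLipschitzGradientOnBox_beta {β : ℝ} {a b : ℝ} (ha : 0 < a) :
    HasLipschitzGradientOnBox (betaDivergence n β) a b := by
  have h : HasLipschitzGradientOnBox (n := n) (fun x y => ∑ i,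
      1 / (β * (β - 1)) * (x i ^ β - y i ^ β - β * (y i ^ (β - 1) * (x i - y i)))) a b := by
    -- The terms `β * y ^ (β - 1)` cancel, leaving a multiple of `(y - x) * y ^ (β - 2)`. The
    -- prefactor stays uncancelled, so the identity also holds when it is `1 / 0 = 0`.
    refine hasLipschitzGradientOnBox_of_rpow (n := n) (ψ := fun x y => 1 / (β * (β - 1)) * (x ^ β - y ^ β - β * (y ^ (β - 1) * (x - y)))) ha
      (A := fun x => 1 / (β * (β - 1)) * (-(β * (β - 1) * x)))
      (B := fun _ => 1 / (β * (β - 1)) * (β * (β - 1))) (by fun_prop)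
      continuousOn_const 0 (β - 1 - 1) (β - 1) fun x hx y hy => ?_
    have h1 : HasDerivAt (fun y : ℝ => y ^ β) (β * y ^ (β - 1)) y :=
      Real.hasDerivAt_rpow_const (Or.inl hy.ne')
    have h3 : HasDerivAt (fun y : ℝ => y ^ (β - 1)) ((β - 1) * y ^ (β - 1 - 1)) y :=
      Real.hasDerivAt_rpow_const (Or.inl hy.ne')
    have h2 := (((h1.const_sub (x ^ β)).sub
      ((h3.mul ((hasDerivAt_id y).const_sub x)).const_mul β)).const_mul (1 / (β * (β - 1))))
    refine h2.congr_deriv ?_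
    have h4 : y ^ (β - 1) = y ^ (β - 1 - 1) * y := by
      rw [← Real.rpow_add_one hy.ne']; congr 1; ring
    simp only [id]
    rw [h4]; ring
  refine h.congr ha fun x hx y hy => ?_
  simp only [betaDivergence, Finset.mul_sum]
  refine Finset.sum_congr rfl fun i _ => ?_
  ring

lemma hasLipschitzGradientOnBox_kl {a b : ℝ} (ha : 0 < a) :
    HasLipschitzGradientOnBox (klDivergence n) a b := by
  have h : HasLipschitzGradientOnBox (n := n) (fun x y => ∑ i,
      (x i * (Real.log (x i) - Real.log (y i)) - x i + y i)) a b := by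
    refine hasLipschitzGradientOnBox_of_rpow (n := n) (ψ := fun x y => x * (Real.log x - Real.log y) - x + y) ha (A := fun x => -x) (B := fun _ => 0) (by fun_prop)
      continuousOn_const 1 (-1) 0 fun x hx y hy => ?_
    have h1 := (((((Real.hasDerivAt_log hy.ne').const_sub (Real.log x)).const_mul x).sub_const
      x).add (hasDerivAt_id y))
    refine h1.congr_deriv ?_
    rw [Real.rpow_neg_one]; ring
  refine h.congr ha fun x hx y hy => ?_
  simp only [klDivergence]
  refine Finset.sum_congr rfl fun i _ => ?_
  rw [Real.log_div (hx i).ne' (hy i).ne']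

lemma hasLipschitzGradientOnBox_itakuraSaito {a b : ℝ} (ha : 0 < a) :
    HasLipschitzGradientOnBox (isDivergence n) a b := by
  have h : HasLipschitzGradientOnBox (n := n) (fun x y => ∑ i,
      (Real.log (y i) - Real.log (x i) + x i * (y i)⁻¹ - 1)) a b := by
    refine hasLipschitzGradientOnBox_of_rpow (n := n) (ψ := fun x y => Real.log y - Real.log x + x * y⁻¹ - 1) ha (A := fun _ => 1) (B := fun x => -x)
      continuousOn_const (by fun_prop) 0 (-1) (-2) fun x hx y hy => ?_
    have h1 := (((Real.hasDerivAt_log hy.ne').sub_const (Real.log x)).add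
      ((hasDerivAt_inv hy.ne').const_mul x)).sub_const 1
    refine h1.congr_deriv ?_
    rw [Real.rpow_neg_one, Real.rpow_neg hy.le]; norm_num
  refine h.congr ha fun x hx y hy => ?_
  simp only [isDivergence]
  refine Finset.sum_congr rfl fun i _ => ?_
  rw [Real.log_div (hy i).ne' (hx i).ne']
  rfl

lemma hasLipschitzGradientOnBox_mahalanobis {A : Matrix (Fin n) (Fin n) ℝ} (hA : A.PosDef)
    (a b : ℝ) : HasLipschitzGradientOnBox (mahalanobis n A) a b := by
  set T : Vec n →L[ℝ] Vec n := Matrix.toEuclideanCLM (𝕜 := ℝ) A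
  have hT : ∀ x y : Vec n, inner ℝ (T x) y = ∑ i, ∑ j, y i * A i j * x j := by
    intro x y
    simp only [T, PiLp.inner_apply, Matrix.ofLp_toEuclideanCLM, Matrix.mulVec, dotProduct]
    refine Finset.sum_congr rfl fun i _ => ?_
    simp [Finset.mul_sum, mul_assoc]
  have hsymm : ∀ x y : Vec n, inner ℝ (T x) y = inner ℝ (T y) x := by
    intro x y
    rw [hT, hT, Finset.sum_comm]
    refine Finset.sum_congr rfl fun i _ => Finset.sum_congr rfl fun j _ => ?_
    have : A j i = A i j := by simpa using hA.isHermitian.apply i j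
    rw [this]; ring
  have hd : ∀ x y, mahalanobis n A x y = inner ℝ (T (x - y)) (x - y) / 2 := by
    intro x y; rw [hT]; rfl
  refine ⟨fun x y => T (y - x), ‖T‖, norm_nonneg _, fun x _ y _ => ⟨fun u => ?_, fun z _ => ?_⟩⟩
  · apply hasDirDeriv_of_hasDerivAt
    have h1 : (fun t : ℝ => mahalanobis n A x (y + t • u)) = fun t => inner ℝ (T (x - y)) (x - y) / 2
        + t * inner ℝ (T (y - x)) u + t ^ 2 * (inner ℝ (T u) u / 2) := by
      ext t
      rw [hd, show x - (y + t • u) = (x - y) - t • u by abel, map_sub T (x - y), map_smul, inner_sub_left,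
        inner_sub_right _ (x - y), inner_sub_right _ (x - y), inner_smul_left, inner_smul_left,
        inner_smul_right, inner_smul_right, hsymm u (x - y), ← neg_sub x y, map_neg,
        inner_neg_left]
      simp only [conj_trivial]
      ring
    rw [h1]
    have h2 := (((hasDerivAt_id (0 : ℝ)).mul_const (inner ℝ (T (y - x)) u)).const_add
      (inner ℝ (T (x - y)) (x - y) / 2)).add
      ((hasDerivAt_pow 2 (0 : ℝ)).mul_const (inner ℝ (T u) u / 2))
    refine h2.congr_deriv ?_
    simp
  · rw [← map_sub, sub_sub_sub_cancel_right]
    exact T.le_opNorm _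

/-! Joint continuity on the positive orthant. -/

lemma continuous_huber (a : ℝ) (ha : 0 < a) : Continuous (huber a) :=
  continuous_iff_continuousAt.2 fun u => (hasDerivAt_huber ha u).continuousAt

lemma IsListed.continuousOn {d : Divergence n} (hd : IsListed n d) :
    ContinuousOn (Function.uncurry d) (posOrthant n ×ˢ posOrthant n) := by
  have hc1 : ∀ i, ContinuousOn (fun p : Vec n × Vec n => p.1 i) (posOrthant n ×ˢ posOrthant n) :=
    fun i => Continuous.continuousOn (by fun_prop)
  have hc2 : ∀ i, ContinuousOn (fun p : Vec n × Vec n => p.2 i) (posOrthant n ×ˢ posOrthant n) :=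
    fun i => Continuous.continuousOn (by fun_prop)
  have hp1 : ∀ i, ∀ p ∈ posOrthant n ×ˢ posOrthant n, (p.1 i : ℝ) ≠ 0 := fun i p hp =>
    (hp.1 i).ne'
  have hp2 : ∀ i, ∀ p ∈ posOrthant n ×ˢ posOrthant n, (p.2 i : ℝ) ≠ 0 := fun i p hp =>
    (hp.2 i).ne'
  cases hd with
  | l1 => exact Continuous.continuousOn (by unfold l1Distance Function.uncurry; fun_prop)
  | l2 => exact Continuous.continuousOn (by unfold l2Distance Function.uncurry; fun_prop)
  | huber a ha =>
    refine Continuous.continuousOn ?_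
    have := continuous_huber a ha
    unfold huberLoss Function.uncurry
    fun_prop
  | alpha a h0 h1 =>
    refine continuousOn_const.mul (continuousOn_finsetSum _ fun i _ => ?_)
    refine ((hc2 i).mul ((((hc1 i).div (hc2 i) (hp2 i)).rpow_const fun p hp =>
      Or.inl (div_ne_zero (hp1 i p hp) (hp2 i p hp))).sub continuousOn_const)).sub
      (continuousOn_const.mul ((hc1 i).sub (hc2 i)))
  | kl =>
    unfold klDivergence Function.uncurry
    refine continuousOn_finsetSum _ fun i _ => ?_
    exact (((hc1 i).mul (((hc1 i).div (hc2 i) (hp2 i)).log fun p hp =>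
      div_ne_zero (hp1 i p hp) (hp2 i p hp))).sub (hc1 i)).add (hc2 i)
  | mahalanobis A hA =>
    exact Continuous.continuousOn (by unfold OnlineNMF.mahalanobis Function.uncurry; fun_prop)
  | beta b h0 h1 =>
    refine continuousOn_const.mul (continuousOn_finsetSum _ fun i _ => ?_)
    exact (((hc1 i).rpow_const fun p hp => Or.inl (hp1 i p hp)).sub
      ((hc2 i).rpow_const fun p hp => Or.inl (hp2 i p hp))).sub
      ((continuousOn_const.mul ((hc2 i).rpow_const fun p hp => Or.inl (hp2 i p hp))).mul
        ((hc1 i).sub (hc2 i)))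
  | itakuraSaito =>
    unfold isDivergence Function.uncurry
    refine continuousOn_finsetSum _ fun i _ => ?_
    exact ((((hc2 i).div (hc1 i) (hp1 i)).log fun p hp =>
      div_ne_zero (hp2 i p hp) (hp1 i p hp)).add ((hc1 i).div (hc2 i) (hp2 i))).sub
      continuousOn_const

end Listed

/-! ### Strong convexity excludes the kinks of the nonsmooth divergences -/

section Kinks

variable {F K : ℕ}

/-- The vector with all entries `c`. -/
noncomputable def constVec (n : ℕ) (c : ℝ) : Vec n := WithLp.toLp 2 fun _ => c

@[simp] lemma constVec_apply (n : ℕ) (c : ℝ) (i : Fin n) : constVec n c i = c := rfl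

lemma constVec_mem_posOrthant (n : ℕ) {c : ℝ} (hc : 0 < c) : constVec n c ∈ posOrthant n :=
  fun _ => hc

/-- Along the ray through `x` the divergence is a nonzero multiple of `|t|`, which is not
differentiable at `0`. -/
lemma notMem_classD1_of_abs {d d₀ : Divergence F}
    (hd : ∀ x ∈ posOrthant F, ∀ y ∈ posOrthant F, d x y = d₀ x y) {c : ℝ} (hc : c ≠ 0)
    (habs : ∀ t : ℝ, d₀ (constVec F 1) (constVec F 1 + t • constVec F 1) = |t| * c) :
    d ∉ classD1 F := by
  intro hD1
  set x := constVec F 1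
  have hx : x ∈ posOrthant F := constVec_mem_posOrthant F one_pos
  have hdiff : DifferentiableAt ℝ (d x) x :=
    (hD1.2 x hx {x} (by simpa using hx) isCompact_singleton).1 x rfl
  have hline : DifferentiableAt ℝ (fun t : ℝ => x + t • x) 0 := by fun_prop
  have h0 : DifferentiableAt ℝ (d x) (x + (0 : ℝ) • x) := by simpa using hdiff
  have h1 : DifferentiableAt ℝ (fun t : ℝ => d x (x + t • x) * c⁻¹) 0 :=
    (h0.comp (0 : ℝ) hline).mul_const c⁻¹
  refine not_differentiableAt_abs_zero (h1.congr_of_eventuallyEq ?_)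
  have hcont : Tendsto (fun t : ℝ => x + t • x) (𝓝 0) (𝓝 x) :=
    Continuous.tendsto' (by fun_prop) 0 x (by simp)
  filter_upwards [hcont.eventually ((isOpen_posOrthant F).mem_nhds hx)] with t ht
  rw [hd x hx _ ht, habs, mul_inv_cancel_right₀ hc]

lemma notMem_classD1_of_l1 (hF : 0 < F) {d : Divergence F}
    (hd : ∀ x ∈ posOrthant F, ∀ y ∈ posOrthant F, d x y = l1Distance F x y) : d ∉ classD1 F := by
  refine notMem_classD1_of_abs hd (c := F) (by positivity) fun t => ?_
  simp [l1Distance, mul_comm]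

lemma notMem_classD1_of_l2 (hF : 0 < F) {d : Divergence F}
    (hd : ∀ x ∈ posOrthant F, ∀ y ∈ posOrthant F, d x y = l2Distance F x y) : d ∉ classD1 F := by
  refine notMem_classD1_of_abs hd (c := ‖constVec F 1‖) ?_ fun t => ?_
  · refine norm_ne_zero_iff.2 fun h => ?_
    have := congrArg (fun x : Vec F => x ⟨0, hF⟩) h
    simp at this
  · rw [l2Distance, sub_add_cancel_left, norm_neg, norm_smul, Real.norm_eq_abs]

lemma not_strongConvexOn_l1 {d : Divergence F}
    (hd : ∀ x ∈ posOrthant F, ∀ y ∈ posOrthant F, d x y = l1Distance F x y)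
    {ε' U m : ℝ} (hε' : 0 < ε') (hU : ε' < U) (hK : 0 < K) (hm : 0 < m) {v : Vec F}
    (hv : v ∈ posOrthant F) :
    ¬ StrongConvexOn (coefSet K ε' U) m
      (sampleObj d 0 v (WithLp.toLp 2 fun _ => 1 : Mat F K)) := by
  intro hsc
  have hK' : (0 : ℝ) < K := by exact_mod_cast hK
  have hval : ∀ c : ℝ, 0 < c → sampleObj d 0 v (WithLp.toLp 2 fun _ => 1 : Mat F K) (constVec K c)
      = ∑ i, |v i - K * c| := by
    intro c hc
    have h1 : ∀ i, mulVec (WithLp.toLp 2 fun _ => 1 : Mat F K) (constVec K c) i = K * c := by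
      intro i; simp
    have h2 : mulVec (WithLp.toLp 2 fun _ => 1 : Mat F K) (constVec K c) ∈ posOrthant F := by
      intro i; rw [h1]; positivity
    simp only [sampleObj, hd v hv _ h2, l1Distance, h1]
    simp
  -- Avoiding finitely many values keeps every residual `v i - K * c` nonzero; for small `s` the
  -- signs persist, so the objective is affine on the segment and violates strong convexity.
  obtain ⟨c, hc, hcv⟩ : ∃ c ∈ Set.Ioo ε' U, c ∉ Set.range fun i => v i / K := by
    have hinf : (Set.Ioo ε' U).Infinite := Set.Ioo_infinite hU
    exact (hinf.sdiff (Set.finite_range fun i => v i / K)).nonempty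
  have hne : ∀ i, 0 < |v i - K * c| := by
    intro i
    refine abs_pos.2 fun h => hcv ⟨i, ?_⟩
    simp only
    rw [div_eq_iff hK'.ne']; linarith
  have hev : ∀ i, ∀ᶠ s : ℝ in 𝓝[>] 0, K * s < |v i - K * c| := by
    intro i
    have : Tendsto (fun s : ℝ => K * s) (𝓝[>] 0) (𝓝 0) :=
      (Continuous.tendsto' (by fun_prop) 0 _ (by simp)).mono_left nhdsWithin_le_nhds
    exact this.eventually (gt_mem_nhds (hne i))
  have hev1 : ∀ᶠ s : ℝ in 𝓝[>] 0, s ∈ Set.Ioo 0 (c - ε') := Ioo_mem_nhdsGT (sub_pos.2 hc.1)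
  have hev2 : ∀ᶠ s : ℝ in 𝓝[>] 0, s ∈ Set.Ioo 0 (U - c) := Ioo_mem_nhdsGT (sub_pos.2 hc.2)
  obtain ⟨s, hs, hs1, hs2⟩ := ((eventually_all.2 hev).and (hev1.and hev2)).exists
  have hpos : 0 < s := hs1.1
  have hc0 : 0 < c - s := by linarith [hs1.2]
  have h1 := hsc.2 (x := constVec K (c + s)) (y := constVec K (c - s))
    (fun i => by simp only [constVec_apply]; constructor <;> linarith [hc.1, hs2.2])
    (fun i => by simp only [constVec_apply]; constructor <;> linarith [hc.2, hs1.2])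
    (show (0 : ℝ) ≤ 1 / 2 by norm_num) (show (0 : ℝ) ≤ 1 / 2 by norm_num) (by norm_num)
  have h2 : (1 / 2 : ℝ) • constVec K (c + s) + (1 / 2 : ℝ) • constVec K (c - s)
      = constVec K c := by
    ext i; simp; ring
  rw [h2, hval c (by linarith), hval (c + s) (by linarith), hval (c - s) hc0] at h1
  have h3 : ∑ i, |v i - K * (c + s)| + ∑ i, |v i - K * (c - s)| = 2 * ∑ i, |v i - K * c| := by
    rw [← Finset.sum_add_distrib, Finset.mul_sum]
    refine Finset.sum_congr rfl fun i _ => ?_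
    have h4 := hs i
    have h5 : 0 < K * s := by positivity
    rw [show v i - K * (c + s) = (v i - K * c) - K * s by ring,
      show v i - K * (c - s) = (v i - K * c) + K * s by ring]
    rcases le_total 0 (v i - K * c) with h6 | h6
    · rw [abs_of_nonneg h6] at h4 ⊢
      rw [abs_of_nonneg (by linarith), abs_of_nonneg (by linarith)]; ring
    · rw [abs_of_nonpos h6] at h4 ⊢
      rw [abs_of_nonpos (by linarith), abs_of_nonpos (by linarith)]; ring
  have h4 : 0 < ‖constVec K (c + s) - constVec K (c - s)‖ := by
    refine norm_pos_iff.2 fun h => ?_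
    have := congrArg (fun x : Vec K => x ⟨0, hK⟩) h
    simp at this
    linarith
  have h5 : 0 < m / 2 * ‖constVec K (c + s) - constVec K (c - s)‖ ^ 2 := by positivity
  simp only [smul_eq_mul] at h1
  linarith

/-- If `W h = v`, the objective is linear along the segment from `h` to any other `k ∈ H`,
contradicting strong convexity at the midpoint. -/
lemma mulVec_ne_of_strongConvexOn_l2 {d : Divergence F}
    (hd : ∀ x ∈ posOrthant F, ∀ y ∈ posOrthant F, d x y = l2Distance F x y)
    {H : Set (Vec K)} (hH : ¬ H.Subsingleton) {m : ℝ} (hm : 0 < m) {v : Vec F} {W : Mat F K}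
    (hv : v ∈ posOrthant F) (hpos : ∀ h ∈ H, mulVec W h ∈ posOrthant F)
    (hsc : StrongConvexOn H m (sampleObj d 0 v W)) {h : Vec K} (hh : h ∈ H) :
    mulVec W h ≠ v := by
  intro hWh
  obtain ⟨k, hk, hkh⟩ := (Set.not_subsingleton_iff.1 hH).exists_ne h
  have hval : ∀ h ∈ H, sampleObj d 0 v W h = ‖v - mulVec W h‖ := by
    intro h hh
    simp [sampleObj, hd v hv _ (hpos h hh), l2Distance]
  have ha : (0 : ℝ) ≤ 1 / 2 := by norm_num
  have hmid := hsc.1 hh hk ha ha (by norm_num)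
  have h1 := hsc.2 hh hk ha ha (by norm_num)
  have h2 : v - mulVec W ((1 / 2 : ℝ) • h + (1 / 2 : ℝ) • k) = (1 / 2 : ℝ) • (v - mulVec W k) := by
    have : mulVec W ((1 / 2 : ℝ) • h + (1 / 2 : ℝ) • k)
        = (1 / 2 : ℝ) • mulVec W h + (1 / 2 : ℝ) • mulVec W k := by
      ext i
      simp [mul_add, Finset.sum_add_distrib, Finset.mul_sum, mul_left_comm]
    rw [this, hWh]; module
  rw [hval _ hmid, hval _ hh, hval _ hk, h2, hWh, norm_smul, Real.norm_of_nonneg ha, sub_self,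
    norm_zero] at h1
  have h3 : 0 < m / 2 * ‖h - k‖ ^ 2 := by
    have : 0 < ‖h - k‖ := norm_pos_iff.2 (sub_ne_zero.2 hkh.symm)
    positivity
  simp only [smul_eq_mul] at h1
  linarith

lemma norm_inv_smul_sub_le {E : Type*} [NormedAddCommGroup E] [NormedSpace ℝ E] {x y : E} {δ : ℝ}
    (hδ : 0 < δ) (hx : δ ≤ ‖x‖) (hy : δ ≤ ‖y‖) :
    ‖‖x‖⁻¹ • x - ‖y‖⁻¹ • y‖ ≤ 2 / δ * ‖x - y‖ := by
  have hx0 : 0 < ‖x‖ := hδ.trans_le hx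
  have hy0 : 0 < ‖y‖ := hδ.trans_le hy
  have h1 : ‖x‖⁻¹ • x - ‖y‖⁻¹ • y = ‖x‖⁻¹ • (x - y) + (‖x‖⁻¹ - ‖y‖⁻¹) • y := by module
  have h2 : ‖(‖x‖⁻¹ - ‖y‖⁻¹) • y‖ ≤ ‖x‖⁻¹ * ‖x - y‖ := by
    rw [norm_smul, Real.norm_eq_abs]
    have : (‖x‖⁻¹ - ‖y‖⁻¹) = ‖x‖⁻¹ * (‖y‖ - ‖x‖) * ‖y‖⁻¹ := by field_simp
    rw [this, abs_mul, abs_mul, abs_of_pos (inv_pos.2 hx0), abs_of_pos (inv_pos.2 hy0),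
      inv_mul_cancel_right₀ hy0.ne', norm_sub_rev x y]
    exact mul_le_mul_of_nonneg_left (abs_norm_sub_norm_le _ _) (inv_pos.2 hx0).le
  rw [h1]
  refine (norm_add_le _ _).trans ?_
  rw [norm_smul ‖x‖⁻¹, norm_inv, norm_norm]
  have h3 : ‖x‖⁻¹ ≤ δ⁻¹ := inv_anti₀ hδ hx
  have h4 := mul_le_mul_of_nonneg_right h3 (norm_nonneg (x - y))
  rw [div_eq_mul_inv]
  linarith

lemma hasDirDeriv_norm_sub {E : Type*} [NormedAddCommGroup E] [InnerProductSpace ℝ E] {x y : E}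
    (hxy : y ≠ x) (u : E) :
    HasDirDeriv (fun z => ‖x - z‖) y u (inner ℝ (‖y - x‖⁻¹ • (y - x)) u) := by
  apply hasDirDeriv_of_hasDerivAt
  have hne : ‖y - x‖ ≠ 0 := norm_ne_zero_iff.2 (sub_ne_zero.2 hxy)
  have h1 : HasDerivAt (fun t : ℝ => (y - x) + t • u) u 0 := by
    simpa using ((hasDerivAt_id (0 : ℝ)).smul_const u).const_add (y - x)
  have h2 := h1.norm_sq.sqrt (by simpa using hne)
  have h3 : (fun t : ℝ => ‖x - (y + t • u)‖) = fun t => Real.sqrt (‖(y - x) + t • u‖ ^ 2) := by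
    ext t
    rw [Real.sqrt_sq (norm_nonneg _), ← norm_neg]
    congr 1; abel
  rw [h3]
  refine h2.congr_deriv ?_
  simp only [zero_smul, add_zero, Real.sqrt_sq (norm_nonneg _), inner_smul_left, conj_trivial]
  field_simp

lemma hasLipschitzGradient_of_box {d d₀ : Divergence F}
    (hd : ∀ x ∈ posOrthant F, ∀ y ∈ posOrthant F, d x y = d₀ x y) {a b : ℝ} (ha : 0 < a)
    {V : Set (Vec F)} {C : Set (Mat F K)} {H : Set (Vec K)} (hV : V ⊆ coefSet F a b)
    (hCH : ∀ W ∈ C, ∀ h ∈ H, mulVec W h ∈ coefSet F a b)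
    (hbox : HasLipschitzGradientOnBox d₀ a b) :
    ∃ γ L, 0 ≤ L ∧ HasLipschitzGradient d V C H γ L := by
  obtain ⟨γ, L, hL, hγ⟩ := hbox.congr ha fun x hx y hy => (hd x hx y hy).symm
  exact ⟨γ, L, hL, fun v hv W hW h hh => ⟨(hγ v (hV hv) _ (hCH W hW h hh)).1,
    fun k hk => (hγ v (hV hv) _ (hCH W hW h hh)).2 _ (hCH W hW k hk)⟩⟩

/-- By compactness `‖W h - v‖` is bounded below by some `δ > 0`, and normalization is `2 /
δ`-Lipschitz at that distance from the origin. -/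
lemma hasLipschitzGradient_of_l2 {d : Divergence F}
    (hd : ∀ x ∈ posOrthant F, ∀ y ∈ posOrthant F, d x y = l2Distance F x y)
    {V : Set (Vec F)} {C : Set (Mat F K)} {H : Set (Vec K)} (hV : IsCompact V) (hC : IsCompact C)
    (hH : IsCompact H) (hVpos : V ⊆ posOrthant F)
    (hCH : ∀ W ∈ C, ∀ h ∈ H, mulVec W h ∈ posOrthant F)
    (hne : ∀ v ∈ V, ∀ W ∈ C, ∀ h ∈ H, mulVec W h ≠ v) :
    ∃ γ L, 0 ≤ L ∧ HasLipschitzGradient d V C H γ L := by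
  have hcont : Continuous fun p : Vec F × (Mat F K × Vec K) => ‖mulVec p.2.1 p.2.2 - p.1‖ :=
    ((continuous_mulVec.comp continuous_snd).sub continuous_fst).norm
  obtain ⟨δ, hδ, hδle⟩ := (hV.prod (hC.prod hH)).exists_forall_le' (a := 0) hcont.continuousOn
    fun p hp => norm_pos_iff.2 (sub_ne_zero.2 (hne p.1 hp.1 p.2.1 hp.2.1 p.2.2 hp.2.2))
  refine ⟨fun v y => ‖y - v‖⁻¹ • (y - v), 2 / δ, by positivity, fun v hv W hW h hh =>
    ⟨fun u => ?_, fun k hk => ?_⟩⟩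
  · refine (hasDirDeriv_norm_sub (hne v hv W hW h hh) u).congr_of_eventuallyEq ?_
    filter_upwards [(isOpen_posOrthant F).mem_nhds (hCH W hW h hh)] with z hz
    exact (hd v (hVpos hv) z hz).symm
  · have := norm_inv_smul_sub_le hδ (hδle (v, W, k) ⟨hv, hW, hk⟩) (hδle (v, W, h) ⟨hv, hW, hh⟩)
    simpa using this

/-- For the divergences of the theorem, either the coefficients are fixed, or `d(v‖·)` has a
Lipschitz gradient at the products `W h`. -/
lemma subsingleton_or_hasLipschitzGradient {d : Divergence F} (hd : d ∈ classD2 F) {lam : ℝ}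
    (hreg : lam = 0 ∨ d ∈ classD1 F) {ε ε' U : ℝ} (hε1 : ε < 1) (hε' : 0 < ε')
    {V : Set (Vec F)} (hV : IsCompact V) (hVne : V.Nonempty)
    {a b : ℝ} (ha : 0 < a) (hVab : V ⊆ coefSet F a b)
    (hCH : ∀ W ∈ dictSet F K ε, ∀ h ∈ coefSet K ε' U, mulVec W h ∈ coefSet F a b)
    {m : ℝ} (hm : 0 < m)
    (hsc : ∀ v ∈ V, ∀ W ∈ dictSet F K ε, StrongConvexOn (coefSet K ε' U) m (sampleObj d lam v W)) :
    (coefSet K ε' U).Subsingleton ∨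
      ∃ γ L, 0 ≤ L ∧ HasLipschitzGradient d V (dictSet F K ε) (coefSet K ε' U) γ L := by
  obtain ⟨d₀, hlist, heq⟩ := hd.1
  have hVpos : V ⊆ posOrthant F := hVab.trans (coefSet_subset_posOrthant F ha)
  have hCHpos : ∀ W ∈ dictSet F K ε, ∀ h ∈ coefSet K ε' U, mulVec W h ∈ posOrthant F :=
    fun W hW h hh => coefSet_subset_posOrthant F ha (hCH W hW h hh)
  -- For `F = 0` the `ℓ₁` and `ℓ₂` distances have no kink and cannot be excluded from `classD1`.
  rcases Nat.eq_zero_or_pos F with rfl | hF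
  · refine Or.inr ⟨fun _ _ => 0, 0, le_rfl, fun v _ W _ h _ => ⟨fun u => ?_, fun k _ => by simp⟩⟩
    simp [HasDirDeriv, Subsingleton.elim u 0]
  have hbox := fun h => hasLipschitzGradient_of_box heq ha hVab hCH h
  cases hlist with
  | l1 =>
    rcases hreg with rfl | h1
    · refine Or.inl (by_contra fun hns => ?_)
      obtain ⟨h, hh, k, hk, hne⟩ := Set.not_subsingleton_iff.1 hns
      obtain ⟨j, hj⟩ : ∃ j, h j ≠ k j := by
        by_contra! hcon
        exact hne (PiLp.ext hcon)
      have hK : 0 < K := j.pos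
      have hU : ε' < U := by
        rcases (hh j).1.lt_or_eq with hlt | hEq
        · exact hlt.trans_le (hh j).2
        · exact lt_of_le_of_ne ((hh j).1.trans (hh j).2) fun hU =>
            hj (le_antisymm ((hh j).2.trans (hU ▸ (hk j).1)) ((hk j).2.trans (hU ▸ (hh j).1)))
      obtain ⟨v, hv⟩ := hVne
      -- The all-ones matrix is a dictionary: its row sums are `K ≥ 1 > ε`.
      refine not_strongConvexOn_l1 heq hε' hU hK hm (hVpos hv) (hsc v hv _ ?_)
      rw [mem_dictSet_iff]
      refine ⟨fun _ _ => zero_le_one, fun i => ?_, fun _ _ => le_rfl⟩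
      have : (1 : ℝ) ≤ K := by exact_mod_cast hK
      simp only [Finset.sum_const, Finset.card_univ, Fintype.card_fin, nsmul_eq_mul, mul_one]
      linarith
    · exact absurd h1 (notMem_classD1_of_l1 hF heq)
  | l2 =>
    rcases hreg with rfl | h1
    · by_cases hs : (coefSet K ε' U).Subsingleton
      · exact Or.inl hs
      · exact Or.inr (hasLipschitzGradient_of_l2 heq hV (isCompact_dictSet F K ε)
          (isCompact_coefSet K ε' U) hVpos hCHpos fun v hv W hW h hh =>
          mulVec_ne_of_strongConvexOn_l2 heq hs hm (hVpos hv) (hCHpos W hW) (hsc v hv W hW) hh)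
    · exact absurd h1 (notMem_classD1_of_l2 hF heq)
  | huber α hα => exact Or.inr (hbox (hasLipschitzGradientOnBox_huberLoss hα a b))
  | alpha α _ _ => exact Or.inr (hbox (hasLipschitzGradientOnBox_alpha ha))
  | kl => exact Or.inr (hbox (hasLipschitzGradientOnBox_kl ha))
  | mahalanobis A hA => exact Or.inr (hbox (hasLipschitzGradientOnBox_mahalanobis hA a b))
  | beta β _ _ => exact Or.inr (hbox (hasLipschitzGradientOnBox_beta ha))
  | itakuraSaito => exact Or.inr (hbox (hasLipschitzGradientOnBox_itakuraSaito ha))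

end Kinks

/-! ### A globally continuous version of the loss -/

section Clamp

variable {F K n : ℕ}

/-- Coordinatewise projection onto the box `[a, b]ⁿ`. -/
noncomputable def clamp (a b : ℝ) (x : Vec n) : Vec n :=
  WithLp.toLp 2 fun i => max a (min (x i) b)

lemma clamp_mem {a b : ℝ} (hab : a ≤ b) (x : Vec n) : clamp a b x ∈ coefSet n a b :=
  fun _ => ⟨le_max_left _ _, max_le hab (min_le_right _ _)⟩

lemma clamp_eq_self {a b : ℝ} {x : Vec n} (hx : x ∈ coefSet n a b) : clamp a b x = x := by
  ext i
  simp [clamp, (hx i).1, (hx i).2]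

lemma continuous_clamp (a b : ℝ) : Continuous (clamp a b : Vec n → Vec n) := by
  unfold clamp
  fun_prop

/-- The divergence composed with the projection onto a box in both arguments. -/
noncomputable def clampDiv (d : Divergence n) (a b : ℝ) : Divergence n :=
  fun x y => d (clamp a b x) (clamp a b y)

lemma continuous_clampDiv {d : Divergence n} {a b : ℝ} (hab : a ≤ b)
    (hd : ContinuousOn (Function.uncurry d) (coefSet n a b ×ˢ coefSet n a b)) :
    Continuous (Function.uncurry (clampDiv d a b)) :=
  hd.comp_continuous (f := fun p : Vec n × Vec n => (clamp a b p.1, clamp a b p.2))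
    (((continuous_clamp a b).comp continuous_fst).prodMk
      ((continuous_clamp a b).comp continuous_snd))
    fun p => ⟨clamp_mem hab p.1, clamp_mem hab p.2⟩

lemma sampleObj_clampDiv {d : Divergence F} {a b lam : ℝ} {v : Vec F} {W : Mat F K} {h : Vec K}
    (hv : v ∈ coefSet F a b) (hWh : mulVec W h ∈ coefSet F a b) :
    sampleObj (clampDiv d a b) lam v W h = sampleObj d lam v W h := by
  simp only [sampleObj, clampDiv, clamp_eq_self hv, clamp_eq_self hWh]

lemma sampleLoss_congr {d d' : Divergence F} {lam : ℝ} {H : Set (Vec K)} {v : Vec F}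
    {W : Mat F K} (h : ∀ h ∈ H, sampleObj d lam v W h = sampleObj d' lam v W h) :
    sampleLoss d lam H v W = sampleLoss d' lam H v W :=
  congrArg sInf (Set.image_congr h)

lemma continuous_sampleObj {d : Divergence F} (hd : Continuous (Function.uncurry d)) (lam : ℝ) :
    Continuous fun p : (Vec F × Mat F K) × Vec K => sampleObj d lam p.1.1 p.1.2 p.2 := by
  have h1 : Continuous fun p : (Vec F × Mat F K) × Vec K => (p.1.1, mulVec p.1.2 p.2) :=
    (continuous_fst.comp continuous_fst).prodMk (continuous_mulVec.comp
      ((continuous_snd.comp continuous_fst).prodMk continuous_snd))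
  exact (hd.comp h1).add (by fun_prop)

lemma continuous_sampleLoss {d : Divergence F} (hd : Continuous (Function.uncurry d)) (lam : ℝ)
    {H : Set (Vec K)} (hH : IsCompact H) :
    Continuous (Function.uncurry (sampleLoss d lam H)) :=
  hH.continuous_sInf (f := fun (p : Vec F × Mat F K) h => sampleObj d lam p.1 p.2 h)
    (continuous_sampleObj hd lam)

lemma abs_sampleLoss_le {d : Divergence F} {lam : ℝ} (hlam : 0 ≤ lam) {H : Set (Vec K)}
    (hne : H.Nonempty) {R M : ℝ} (hR : ∀ h ∈ H, ‖h‖ ≤ R) (hM : ∀ x y, |d x y| ≤ M) (v : Vec F)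
    (W : Mat F K) : |sampleLoss d lam H v W| ≤ M + lam / 2 * R ^ 2 := by
  have hb : ∀ h ∈ H, |sampleObj d lam v W h| ≤ M + lam / 2 * R ^ 2 := by
    intro h hh
    refine (abs_add_le _ _).trans (add_le_add (hM _ _) ?_)
    rw [abs_of_nonneg (by positivity)]
    exact mul_le_mul_of_nonneg_left (pow_le_pow_left₀ (norm_nonneg _) (hR h hh) 2) (by positivity)
  obtain ⟨h, hh⟩ := hne
  have hbelow : ∀ x ∈ sampleObj d lam v W '' H, -(M + lam / 2 * R ^ 2) ≤ x := by
    rintro _ ⟨k, hk, rfl⟩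
    exact (abs_le.1 (hb k hk)).1
  refine abs_le.2 ⟨le_csInf ⟨_, h, hh, rfl⟩ hbelow, ?_⟩
  exact (csInf_le ⟨_, hbelow⟩ ⟨h, hh, rfl⟩).trans (abs_le.1 (hb h hh)).2

end Clamp

/-! ### Adjusting `ρ`, and criticality of zeros of the gap. -/

lemma HasWeakLowerBound.mono {F K : ℕ} {d : Divergence F} {lam : ℝ} {V : Set (Vec F)}
    {C : Set (Mat F K)} {H : Set (Vec K)} {ρ ρ' : ℝ} (h : HasWeakLowerBound d lam V C H ρ)
    (hρ : ρ ≤ ρ') : HasWeakLowerBound d lam V C H ρ' := by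
  intro v hv W hW Z hZ k hk hkm D hD
  have h1 := h v hv W hW Z hZ k hk hkm D hD
  have h2 := mul_le_mul_of_nonneg_right hρ (sq_nonneg ‖Z - W‖)
  linarith

/-- Along a segment issuing from `x` the quadratic term is `O(δ ^ 2)` and disappears from the
one-sided derivative. -/
lemma mem_criticalPoints_of_quadratic_bound {E : Type*} [NormedAddCommGroup E]
    [InnerProductSpace ℝ E] {C : Set E} (hC : Convex ℝ C) {f : E → ℝ} {ρ : ℝ} {x : E} (hx : x ∈ C)
    (hdir : ∀ y ∈ C, ∃ D, HasDirDeriv f x (y - x) D)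
    (hmin : ∀ z ∈ C, f x ≤ f z + ρ / 2 * ‖z - x‖ ^ 2) : x ∈ criticalPoints f C := by
  refine ⟨hx, fun y hy => ?_⟩
  obtain ⟨D, hD⟩ := hdir y hy
  refine ⟨D, hD, ?_⟩
  have hlow : Tendsto (fun δ : ℝ => -(ρ / 2 * δ * ‖y - x‖ ^ 2)) (𝓝[>] 0) (𝓝 0) :=
    (Continuous.tendsto' (by fun_prop) 0 _ (by simp)).mono_left nhdsWithin_le_nhds
  refine le_of_tendsto_of_tendsto hlow hD ?_
  filter_upwards [Ioo_mem_nhdsGT (zero_lt_one' ℝ)] with δ hδ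
  have h1 := hmin _ (add_smul_sub_mem_of_convex hC hx hy hδ)
  rw [add_sub_cancel_left, norm_smul, Real.norm_of_nonneg hδ.1.le] at h1
  rw [le_div_iff₀ hδ.1]
  linarith [show -(ρ / 2 * δ * ‖y - x‖ ^ 2) * δ = -(ρ / 2 * (δ * ‖y - x‖) ^ 2) by ring]

/-! ### Convergence of the algorithm -/

/-- The stochastic argument needs a loss that is continuous and bounded everywhere, whereas `d` is
controlled only near the data and the products; `dc` supplies such a loss, equal to the original on
`V` and `C`. -/
theorem IsOnlineNMF.tendsto_infEDist_criticalPoints {F K : ℕ} {Ω : Type*} [mΩ : MeasurableSpace Ω]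
    {μ : Measure Ω} [IsProbabilityMeasure μ] {P : Measure (Vec F)} [IsProbabilityMeasure P]
    {d dc : Divergence F} {lam : ℝ} {V : Set (Vec F)} {C : Set (Mat F K)} {H : Set (Vec K)}
    {M r R ρ m Mc : ℝ} (hb : LossBounds d V C H M r R) (hC : IsCompact C) (hCconv : Convex ℝ C)
    (hρ : HasWeakLowerBound d lam V C H ρ) (hρ0 : 0 < ρ) (hm : 0 < m)
    (hsc : ∀ v ∈ V, ∀ W ∈ C, StrongConvexOn H m (sampleObj d lam v W))
    (hmin : ∀ v ∈ V, ∀ W ∈ C, ∃ h ∈ H, IsMinOn (sampleObj d lam v W) H h)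
    (hP : ∀ᵐ v ∂P, v ∈ V)
    (hint : ∀ W ∈ C, Integrable (fun v => sampleLoss d lam H v W) P)
    (hcont : Continuous (Function.uncurry (sampleLoss dc lam H (K := K))))
    (hMc : ∀ v (W : Mat F K), |sampleLoss dc lam H v W| ≤ Mc)
    (hdc : ∀ v ∈ V, ∀ W ∈ C, sampleLoss dc lam H v W = sampleLoss d lam H v W)
    {η : ℕ → ℝ} (hη0 : ∀ t, 0 ≤ η t)
    (hη1 : Tendsto (fun n => ∑ t ∈ Finset.range n, η t) atTop atTop)
    (hη2 : Summable fun t => η t ^ 2)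
    {ℱ : Filtration ℕ mΩ} {v : ℕ → Ω → Vec F} {h : ℕ → Ω → Vec K} {G W : ℕ → Ω → Mat F K}
    (hrun : IsOnlineNMF μ ℱ P d lam C H η v h G W) :
    ∀ᵐ ω ∂μ, Tendsto
      (fun t => Metric.infEDist (W t ω) (criticalPoints (expLoss d lam H P) C)) atTop (𝓝 0) := by
  have hWC : ∀ t, ∀ᵐ ω ∂μ, W t ω ∈ C := by
    intro t
    cases t with
    | zero => exact hrun.init
    | succ t => exact (hrun.update t).mono fun ω hω => hω.1
  have hne : C.Nonempty := (hWC 0).exists.elim fun ω hω => ⟨_, hω⟩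
  have hvm : ∀ t, Measurable (v t) := fun t => (hrun.measurable_v t).mono (ℱ.le _) le_rfl
  have hWm : ∀ t, Measurable (W t) := fun t => (hrun.measurable_W t).mono (ℱ.le _) le_rfl
  have hvV : ∀ t, ∀ᵐ ω ∂μ, v t ω ∈ V := fun t =>
    ae_of_ae_map (hvm t).aemeasurable (by rw [hrun.law_v t]; exact hP)
  have hind : ∀ t, IndepFun (v t) (W t) μ := fun t =>
    indep_of_indep_of_le_right (hrun.indep_v t) (hrun.measurable_W t).comap_le
  set N := 2 * M / r * R with hN
  have hN0 : 0 ≤ N := mul_nonneg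
    (div_nonneg (mul_nonneg zero_le_two hb.M_nonneg) hb.r_pos.le) hb.R_nonneg
  have hexp : ∀ Z ∈ C, ∫ x, sampleLoss dc lam H x Z ∂P = expLoss d lam H P Z := fun Z hZ =>
    integral_congr_ae (hP.mono fun x hx => hdc x hx Z hZ)
  have hlip : ∀ x ∈ C, ∀ y ∈ C, |∫ p, sampleLoss dc lam H p x ∂P - ∫ p, sampleLoss dc lam H p y ∂P|
      ≤ N * ‖x - y‖ := by
    intro x hx y hy
    rw [hexp x hx, hexp y hy, expLoss, expLoss, ← integral_sub (hint x hx) (hint y hy)]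
    have := norm_integral_le_of_norm_le_const (μ := P) (C := N * ‖x - y‖)
      (f := fun p => sampleLoss d lam H p x - sampleLoss d lam H p y)
      (hP.mono fun p hp => hb.abs_sampleLoss_sub_le hmin hp hx hy)
    simpa using this
  have hsub : ∀ t, ∀ᵐ ω ∂μ, ‖G t ω‖ ≤ N ∧ ∀ z ∈ C, inner ℝ (G t ω) (z - W t ω) ≤
      sampleLoss dc lam H (v t ω) z - sampleLoss dc lam H (v t ω) (W t ω)
        + ρ / 2 * ‖z - W t ω‖ ^ 2 := by
    intro t
    filter_upwards [hWC t, hvV t, hrun.coef t, hrun.subgrad t] with ω hW hv hh hG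
    obtain ⟨hhH, hhm⟩ := isMinOn_of_mem_criticalPoints
      ((hsc _ hv _ hW).convexOn fun x => by positivity) hh
    refine ⟨hb.norm_subgradient_le hv hW hhH hG, fun z hz => ?_⟩
    rw [hdc _ hv _ hz, hdc _ hv _ hW]
    exact hb.inner_le_of_subgradient hρ hv hW hz hhH hhm hG
  -- The factor `2` comes from the triangle inequality in `norm_sub_projection_le`.
  have hgap := tendsto_moreau_gap hcont hMc hC hne (B := 2 * N) (L := N) hρ0 (by positivity) hN0
    hlip hη0 hη1 hη2 hvm hWm hrun.law_v hind hWC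
    (fun t => by
      filter_upwards [hWC t, hsub t, hrun.update t] with ω hW hG hp
      refine (norm_sub_projection_le (hη0 t) hW hp).trans ?_
      linarith [mul_le_mul_of_nonneg_left hG.1 (hη0 t)])
    (fun t => by
      filter_upwards [hsub t, hrun.update t] with ω hG hp z hz
      refine (projection_step_sq_le hCconv hz hp).trans ?_
      have h1 := mul_le_mul_of_nonneg_left (hG.2 z hz) (mul_nonneg zero_le_two (hη0 t))
      have h2 : ‖G t ω‖ ^ 2 ≤ (2 * N) ^ 2 :=
        pow_le_pow_left₀ (norm_nonneg _) (by linarith [hG.1]) 2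
      have h3 := mul_le_mul_of_nonneg_left h2 (sq_nonneg (η t))
      linarith)
  have hf := continuous_integral_loss (P := P) hcont hMc
  filter_upwards [hgap, ae_all_iff.2 hWC] with ω hω hCω
  refine tendsto_infEDist_of_tendsto_gap hC
    (hf.sub (continuous_moreauEnv hC ρ hf)).continuousOn
    (fun x hx => sub_nonneg.2 (moreauEnv_le_self hC ρ hf hx)) (fun x hx hx0 => ?_) hCω hω
  refine mem_criticalPoints_of_quadratic_bound hCconv (ρ := ρ) hx
    (fun y hy => hb.exists_hasDirDeriv_expLoss hCconv hρ hmin hP hint hx hy) fun z hz => ?_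
  have h1 := moreauEnv_le hC ρ hf x hz
  rw [← sub_eq_zero.1 hx0] at h1
  simpa only [hexp x hx, hexp z hz] using h1

end OnlineNMF

/-! ### Choice of constants and assembly. -/

open OnlineNMF in
theorem theorem1 {F K : ℕ} {Ω : Type*} [mΩ : MeasurableSpace Ω]
    (μ : Measure Ω) [IsProbabilityMeasure μ]
    (P : Measure (OnlineNMF.Vec F)) [IsProbabilityMeasure P]
    (ε ε' U : ℝ) (hε : 0 < ε) (hε1 : ε < 1) (hε' : 0 < ε') (hU : ε' ≤ U)
    (d : OnlineNMF.Divergence F) (hd : d ∈ OnlineNMF.classD2 F)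
    (lam : ℝ) (hlam : 0 ≤ lam) (hreg : lam = 0 ∨ d ∈ OnlineNMF.classD1 F)
    -- the data distribution has compact support in the positive orthant
    (hcpt : IsCompact P.support) (hpos : P.support ⊆ OnlineNMF.posOrthant F)
    -- the per-sample coefficient problem is uniformly strongly convex
    (m : ℝ) (hm : 0 < m)
    (hsc : ∀ v ∈ P.support, ∀ W ∈ OnlineNMF.dictSet F K ε,
      StrongConvexOn (OnlineNMF.coefSet K ε' U) m (OnlineNMF.sampleObj d lam v W))
    -- step sizes
    (η : ℕ → ℝ) (hη0 : ∀ t, 0 ≤ η t)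
    (hη1 : Tendsto (fun n => ∑ t ∈ Finset.range n, η t) atTop atTop)
    (hη2 : Summable fun t => η t ^ 2)
    -- a run of the algorithm
    (ℱ : Filtration ℕ mΩ) (v : ℕ → Ω → OnlineNMF.Vec F) (h : ℕ → Ω → OnlineNMF.Vec K)
    (G W : ℕ → Ω → OnlineNMF.Mat F K)
    (hrun : OnlineNMF.IsOnlineNMF μ ℱ P d lam (OnlineNMF.dictSet F K ε)
      (OnlineNMF.coefSet K ε' U) η v h G W) :
    -- the expected loss is well defined and directionally differentiable on the dictionaries
    (∀ W₀ ∈ OnlineNMF.dictSet F K ε,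
      (∀ v₀ ∈ P.support, ∃ h₀ ∈ OnlineNMF.coefSet K ε' U,
        OnlineNMF.sampleObj d lam v₀ W₀ h₀ =
          OnlineNMF.sampleLoss d lam (OnlineNMF.coefSet K ε' U) v₀ W₀ ∧
        IsMinOn (OnlineNMF.sampleObj d lam v₀ W₀) (OnlineNMF.coefSet K ε' U) h₀) ∧
      Integrable (fun v₀ => OnlineNMF.sampleLoss d lam (OnlineNMF.coefSet K ε' U) v₀ W₀) P ∧
      ∀ W₁ ∈ OnlineNMF.dictSet F K ε, ∃ D, OnlineNMF.HasDirDeriv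
        (OnlineNMF.expLoss d lam (OnlineNMF.coefSet K ε' U) P) W₀ (W₁ - W₀) D) ∧
    -- almost sure convergence to the set of critical points
    ∀ᵐ ω ∂μ, Tendsto
      (fun t => Metric.infEDist (W t ω) (OnlineNMF.criticalPoints
        (OnlineNMF.expLoss d lam (OnlineNMF.coefSet K ε' U) P) (OnlineNMF.dictSet F K ε)))
      atTop (𝓝 0) := by
  obtain ⟨d₀, hlist, heq⟩ := hd.1
  obtain ⟨a₀, b₀, ha₀, hVab₀⟩ := exists_coefSet_of_isCompact hcpt hpos
  set C := dictSet F K ε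
  set H := coefSet K ε' U
  have hC : IsCompact C := isCompact_dictSet F K ε
  have hH : IsCompact H := isCompact_coefSet K ε' U
  have hHne : H.Nonempty := ⟨constVec K ε', fun _ => ⟨le_rfl, hU⟩⟩
  -- Entries of `W h` are at least `ε * ε'`, so balls of radius `r` around the products stay in the
  -- positive orthant. The box `[a, b]` contains these balls and the support; the outer `max`
  -- ensures `a ≤ b`, which the clamp needs.
  set r := ε * ε' / 2 with hr
  have hr0 : 0 < r := by positivity
  set a := min a₀ r
  set b := max a (max b₀ (K * U + r))
  have ha : 0 < a := lt_min ha₀ hr0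
  have hab : a ≤ b := le_max_left _ _
  have hVab : P.support ⊆ coefSet F a b := fun x hx i =>
    ⟨(min_le_left _ _).trans (hVab₀ hx i).1,
      (hVab₀ hx i).2.trans ((le_max_left _ _).trans (le_max_right _ _))⟩
  have hball : ∀ W ∈ C, ∀ h ∈ H, Metric.closedBall (mulVec W h) r ⊆ coefSet F a b := by
    intro W hW h hh y hy i
    have h1 := closedBall_subset_coefSet (mulVec_mem_coefSet hε' hW hh) hy i
    exact ⟨(min_le_right _ _).trans (by linarith [h1.1]),
      h1.2.trans ((le_max_right _ _).trans (le_max_right _ _))⟩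
  have hCH : ∀ W ∈ C, ∀ h ∈ H, mulVec W h ∈ coefSet F a b := fun W hW h hh =>
    hball W hW h hh (Metric.mem_closedBall_self hr0.le)
  have hbox : coefSet F a b ⊆ posOrthant F := coefSet_subset_posOrthant F ha
  have hdcont : ContinuousOn (Function.uncurry d) (coefSet F a b ×ˢ coefSet F a b) :=
    (hlist.continuousOn.mono (Set.prod_mono hbox hbox)).congr fun p hp =>
      heq p.1 (hbox hp.1) p.2 (hbox hp.2)
  obtain ⟨M, hM⟩ := ((isCompact_coefSet F a b).prod
    (isCompact_coefSet F a b)).exists_bound_of_continuousOn hdcont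
  obtain ⟨R, hR⟩ := hH.exists_bound_of_continuousOn (f := fun h => h) continuousOn_id
  obtain ⟨B, hB⟩ := hC.exists_bound_of_continuousOn (f := fun W => W) continuousOn_id
  set dc := clampDiv d a b
  have hdc : Continuous (Function.uncurry dc) := continuous_clampDiv hab hdcont
  have hMc : ∀ x y, |dc x y| ≤ M := fun x y => hM (_, _) ⟨clamp_mem hab x, clamp_mem hab y⟩
  have hobj : ∀ v ∈ P.support, ∀ W ∈ C, ∀ h ∈ H,
      sampleObj dc lam v W h = sampleObj d lam v W h := fun v hv W hW h hh =>
    sampleObj_clampDiv (hVab hv) (hCH W hW h hh)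
  have hloss : ∀ v ∈ P.support, ∀ W ∈ C, sampleLoss dc lam H v W = sampleLoss d lam H v W :=
    fun v hv W hW => sampleLoss_congr (hobj v hv W hW)
  have hlossc : Continuous (Function.uncurry (sampleLoss dc lam H (K := K))) :=
    continuous_sampleLoss hdc lam hH
  have hlossb := abs_sampleLoss_le (K := K) hlam hHne hR hMc
  have hPV : ∀ᵐ x ∂P, x ∈ P.support := Measure.support_mem_ae
  have hmin : ∀ v ∈ P.support, ∀ W ∈ C, ∃ h ∈ H, IsMinOn (sampleObj d lam v W) H h := by
    intro v hv W hW
    have hcont : Continuous (sampleObj dc lam v W) :=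
      (continuous_sampleObj hdc lam).comp (by fun_prop : Continuous fun h : Vec K => ((v, W), h))
    exact hH.exists_isMinOn hHne (hcont.continuousOn.congr fun h hh => (hobj v hv W hW h hh).symm)
  have hint : ∀ W ∈ C, Integrable (fun v => sampleLoss d lam H v W) P := by
    intro W hW
    have h1 : Integrable (fun v => sampleLoss dc lam H v W) P :=
      Integrable.of_bound (hlossc.comp (by fun_prop : Continuous fun v : Vec F =>
        (v, W))).measurable.aestronglyMeasurable _ (ae_of_all _ fun v => hlossb v W)
    exact h1.congr (hPV.mono fun v hv => hloss v hv W hW)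
  have hb : LossBounds d P.support C H (max M 0) r (max R 0) :=
    { M_nonneg := le_max_right _ _
      r_pos := hr0
      R_nonneg := le_max_right _ _
      convexOn := fun v hv => hd.2 v (hpos hv)
      ball_subset := fun W hW h hh => (hball W hW h hh).trans hbox
      bound := fun v hv W hW h hh y hy =>
        (hM (v, y) ⟨hVab hv, hball W hW h hh hy⟩).trans (le_max_left _ _)
      norm_le := fun h hh => (hR h hh).trans (le_max_left _ _) }
  obtain ⟨ρ, hρ⟩ : ∃ ρ, HasWeakLowerBound d lam P.support C H ρ := by
    rcases subsingleton_or_hasLipschitzGradient hd hreg hε1 hε' hcpt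
      (Measure.nonempty_support (IsProbabilityMeasure.ne_zero P)) ha hVab hCH hm hsc with hs | hg
    · exact ⟨0, hb.hasWeakLowerBound_of_subsingleton hs le_rfl⟩
    · obtain ⟨γ, L, hL, hγ⟩ := hg
      exact ⟨_, hb.hasWeakLowerBound_of_lipschitz hm hsc hmin hL (le_max_right B 0)
        (fun W hW => (hB W hW).trans (le_max_left _ _)) hγ⟩
  have hCconv : Convex ℝ C := convex_dictSet F K ε
  refine ⟨fun W₀ hW₀ => ⟨fun v₀ hv₀ => ?_, hint W₀ hW₀, fun W₁ hW₁ =>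
    hb.exists_hasDirDeriv_expLoss hCconv hρ hmin hPV hint hW₀ hW₁⟩, ?_⟩
  · obtain ⟨h₀, hh₀, hmin₀⟩ := hmin v₀ hv₀ W₀ hW₀
    exact ⟨h₀, hh₀, (sampleLoss_eq_of_isMinOn hh₀ hmin₀).symm, hmin₀⟩
  -- The convergence argument divides by `ρ`, so it is raised to at least `1`.
  · exact hrun.tendsto_infEDist_criticalPoints hb hC hCconv (hρ.mono (le_max_left ρ 1))
      (lt_max_of_lt_right one_pos) hm hsc hmin hPV hint hlossc hlossb hloss hη0 hη1 hη2
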